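/- Let $0\le m<n$, let $V$ be a real vector space of dimension $n+1$, $P^n=P(V)$, and let $Q$ be a nondegenerate (possibly imaginary) hyperquadric of $P^n$ given by a nondegenerate symmetric bilinear form $(\cdot,\cdot)$ on $V$. Let $p_0$ be an $m$-dimensional subspace of $P^n$ not tangent to $Q$, and let $U\subseteq G(m,n)$ be the set of all $m$-dimensional subspaces $p$ not tangent to $Q$ such that the restrictions of the form to $p$ and to its polar subspace $p^*=\nu(p)$ (the $(n-m-1)$-dimensional subspace conjugate to $p$) have the same signatures as for $p_0$. Indices run over $0\le\alpha,\beta,\gamma,\delta,\varepsilon\le m$ and $m+1\le h,i,j,k,l\le n$, and repeated indices are summed. For a smooth field of frames $\{A_\alpha,A_i\}$ with $A_\alpha\in p$, $A_i\in p^*$ over local coordinates on $U$, put $dA_\alpha=\omega_\alpha^\beta A_\beta+\omega_\alpha^iA_i$, $dA_i=\omega_i^\alpha A_\alpha+\omega_i^jA_j$; the $\omega_\alpha^i$ form a basis of the 1-forms. Define: * the fundamental tensor $\lambda_{ij}^{\alpha\beta}$ of $\nu$ by $\omega_i^\alpha=\lambda_{ij}^{\alpha\beta}\omega_\beta^j$.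 The normalization $\nu$ is *harmonic* if $\lambda_{ij}^{\alpha\beta}=\lambda_{ji}^{\beta\alpha}$, and *nondegenerate* if the square matrix $(\lambda_{ij}^{\alpha\beta})$ of order $(m+1)(n-m)$ has full rank; * the quadratic form $g=\omega_i^\alpha\omega_\alpha^i$; * the affine connection $\Gamma^\nu$ with connection forms $\omega_{\alpha j}^{i\beta}=\delta_\alpha^\beta\omega_j^i-\delta_j^i\omega_\alpha^\beta$ in the coframe $\omega_\alpha^i$, its curvature forms $\Omega_{\alpha j}^{i\beta}=d\omega_{\alpha j}^{i\beta}+\omega_{\alpha k}^{i\gamma}\wedge\omega_{\gamma j}^{k\beta}$, its curvature tensor, defined by $\Omega_{\alpha j}^{i\beta}=R_{\alpha jkl}^{i\beta\gamma\varepsilon}\,\omega_\varepsilon^l\wedge\omega_\gamma^k$ with coefficients skew-symmetric under $(\gamma,k)\leftrightarrow(\varepsilon,l)$, and its Ricci tensor $R_{jk}^{\beta\gamma}=R_{\alpha jki}^{i\beta\gamma\alpha}$; * the Gram matrices $g_{\alpha\beta}=(A_\alpha,A_\beta)$, $g_{ij}=(A_i,A_j)$, the inverse $(g^{\alpha\beta})$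 of $(g_{\alpha\beta})$, and $R_{ijkl}^{\alpha\beta\gamma\varepsilon}=g^{\alpha\delta}g_{ih}R_{\delta jkl}^{h\beta\gamma\varepsilon}$. Then $U$ is an open domain of $G(m,n)$ containing $p_0$, $\nu$ is a smooth normalization of $U$ (each $\nu(p)$ is an $(n-m-1)$-dimensional subspace having no common points with $p$, and smooth frame fields as above exist near every $p\in U$), and for every such frame field over local coordinates the following hold. 1. The matrices $(g_{\alpha\beta})$ and $(g_{ij})$ are invertible and $\lambda_{ij}^{\alpha\beta}=-g^{\alpha\beta}g_{ij}$. 2. The normalization $\nu$ is harmonic and nondegenerate. 3. The fundamental tensor is covariantly constant with respect to $\Gamma^\nu$: $\nabla\lambda_{ij}^{\alpha\beta}=d\lambda_{ij}^{\alpha\beta}-\lambda_{ik}^{\alpha\beta}\omega_j^k-\lambda_{kj}^{\alpha\beta}\omega_i^k+\lambda_{ij}^{\alpha\gamma}\omega_\gamma^\beta+\lambda_{ij}^{\gamma\beta}\omega_\gamma^\alpha=0$. The normalized domain is homogeneous: the projective transformations of $P^n$ that preserve $U$ and $\nu$ act transitively on $U$. 4. The form $g=-g^{\alpha\beta}g_{ij}\,\omega_\alpha^i\omega_\beta^j$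 does not depend on the choice of the coordinates and frames and is a (pseudo-)Riemannian metric on $U$, and $\Gamma^\nu$ is its Levi-Civita connection. 5. The curvature tensor is $$R_{ijkl}^{\alpha\beta\gamma\varepsilon}=\tfrac12\bigl(g^{\alpha\beta}g^{\gamma\varepsilon}(g_{il}g_{jk}-g_{ik}g_{jl})+(g^{\alpha\varepsilon}g^{\beta\gamma}-g^{\alpha\gamma}g^{\beta\varepsilon})g_{ij}g_{kl}\bigr).$$ 6. The Ricci tensor is $R_{jk}^{\beta\gamma}=\tfrac12(n-1)\,g^{\beta\gamma}g_{jk}$, that is, $-\tfrac12(n-1)$ times the metric tensor $-g^{\beta\gamma}g_{jk}$ of $g$; hence $U$ with the metric $g$ is an Einstein space. -/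

import Mathlib

open Set Module
open scoped ContDiff

namespace Grassmann

noncomputable section

/-! A projective space of dimension `n` is the projectivization of a real vector space `V` of
dimension `n + 1`, and its `m`-dimensional subspaces are the linear subspaces of `V` of dimension
`m + 1`.  The index types `a` and `b` play the role of the ranges `0 ≤ α, β, γ, … ≤ m` and
`m + 1 ≤ i, j, k, … ≤ n`. -/

variable {a b : Type} [Fintype a] [Fintype b] [DecidableEq a] [DecidableEq b]
variable {V : Type*} [NormedAddCommGroup V] [NormedSpace ℝ V] [FiniteDimensional ℝ V]

/-- The coordinate space `ℝ^ρ`, `ρ = |a| |b|`, in which local coordinates on the Grassmannian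
take their values. -/
abbrev Coord (a b : Type) : Type := a → b → ℝ

section Forms

/-! ### The forms attached to a family of frames depending on local coordinates

`A x (Sum.inl α)` is the point `A_α` and `A x (Sum.inr i)` is the point `A_i`. -/

variable (A : Coord a b → Basis (a ⊕ b) ℝ V)

/-- The form `ω_ξ^η`, defined by `d A_ξ = ∑_η ω_ξ^η A_η`. -/
def omega (ξ η : a ⊕ b) (x : Coord a b) : Coord a b →L[ℝ] ℝ :=
  (LinearMap.toContinuousLinearMap ((A x).coord η)).comp (fderiv ℝ (fun y => A y ξ) x)

/-- The basis forms `ω_α^i`, collected into one form with values in `ℝ^ρ`. -/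
def theta (x : Coord a b) : Coord a b →L[ℝ] Coord a b :=
  ContinuousLinearMap.pi fun α => ContinuousLinearMap.pi fun i =>
    omega A (Sum.inl α) (Sum.inr i) x

/-- The vectors `e` dual to the basis forms: `ω_β^j` is `1` on `dual A α i x` if `β = α`, `j = i`
and `0` otherwise (meaningful where `theta A x` is invertible). -/
def dual (α : a) (i : b) (x : Coord a b) : Coord a b :=
  (theta A x).inverse (Pi.single α (Pi.single i 1))

/-- The fundamental tensor `λ_{ij}^{αβ}`: the coefficients in `ω_i^α = λ_{ij}^{αβ} ω_β^j`. -/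
def fundTensor (α β : a) (i j : b) (x : Coord a b) : ℝ :=
  omega A (Sum.inr i) (Sum.inl α) x (dual A β j x)

/-- The matrix `(λ_{ij}^{αβ})` of order `ρ`, with rows `(α, i)` and columns `(β, j)`. -/
def fundMatrix (x : Coord a b) : Matrix (a × b) (a × b) ℝ :=
  Matrix.of fun r c => fundTensor A r.1 c.1 r.2 c.2 x

/-- `∇ λ_{ij}^{αβ} = d λ_{ij}^{αβ} - λ_{ik}^{αβ} ω_j^k - λ_{kj}^{αβ} ω_i^k
  + λ_{ij}^{αγ} ω_γ^β + λ_{ij}^{γβ} ω_γ^α`, evaluated on the vector `v`. -/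
def nablaFund (α β : a) (i j : b) (x v : Coord a b) : ℝ :=
  fderiv ℝ (fundTensor A α β i j) x v
    - (∑ k, fundTensor A α β i k x * omega A (Sum.inr j) (Sum.inr k) x v)
    - (∑ k, fundTensor A α β k j x * omega A (Sum.inr i) (Sum.inr k) x v)
    + (∑ γ, fundTensor A α γ i j x * omega A (Sum.inl γ) (Sum.inl β) x v)
    + (∑ γ, fundTensor A γ β i j x * omega A (Sum.inl γ) (Sum.inl α) x v)

/-- The symmetric bilinear form of the quadratic form `g = ∑ ω_i^α ω_α^i`. -/
def metric (x : Coord a b) : LinearMap.BilinForm ℝ (Coord a b) :=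
  (1 / 2 : ℝ) • ∑ α : a, ∑ i : b,
    (LinearMap.BilinForm.linMulLin
        (omega A (Sum.inr i) (Sum.inl α) x : Coord a b →ₗ[ℝ] ℝ)
        (omega A (Sum.inl α) (Sum.inr i) x : Coord a b →ₗ[ℝ] ℝ)
      + LinearMap.BilinForm.linMulLin
        (omega A (Sum.inl α) (Sum.inr i) x : Coord a b →ₗ[ℝ] ℝ)
        (omega A (Sum.inr i) (Sum.inl α) x : Coord a b →ₗ[ℝ] ℝ))

/-- The connection forms `ω_{αj}^{iβ} = δ_α^β ω_j^i - δ_j^i ω_α^β` of `Γ^ν`, in the coframe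
`ω_α^i`; the arguments `α i` are the row (differentiated component) and `β j` the column. -/
def connForm (α : a) (i : b) (β : a) (j : b) (x : Coord a b) : Coord a b →L[ℝ] ℝ :=
  (1 : Matrix a a ℝ) α β • omega A (Sum.inr j) (Sum.inr i) x
    - (1 : Matrix b b ℝ) j i • omega A (Sum.inl α) (Sum.inl β) x

/-- The covariant derivative `D_X Y` of the connection `Γ^ν`: its components in the coframe are
`ω_α^i (D_X Y) = X (ω_α^i (Y)) + ω_{αj}^{iβ}(X) ω_β^j (Y)`. -/
def covDeriv (X Y : Coord a b → Coord a b) (x : Coord a b) : Coord a b :=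
  (theta A x).inverse fun α i =>
    fderiv ℝ (fun y => theta A y (Y y) α i) x (X x)
      + ∑ β, ∑ j, connForm A α i β j x (X x) * theta A x (Y x) β j

/-- The exterior derivative of a 1-form, evaluated on two (constant) vectors. -/
def extDerivOne (σ : Coord a b → (Coord a b →L[ℝ] ℝ)) (x v w : Coord a b) : ℝ :=
  fderiv ℝ σ x v w - fderiv ℝ σ x w v

/-- The curvature forms `Ω_{αj}^{iβ} = d ω_{αj}^{iβ} + ∑ ω_{αk}^{iγ} ∧ ω_{γj}^{kβ}` of `Γ^ν`. -/
def curvForm (α : a) (i : b) (β : a) (j : b) (x v w : Coord a b) : ℝ :=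
  extDerivOne (connForm A α i β j) x v w
    + ∑ γ, ∑ k, (connForm A α i γ k x v * connForm A γ k β j x w
        - connForm A α i γ k x w * connForm A γ k β j x v)

/-- The curvature tensor `R_{αjkl}^{iβγε}`: the coefficients, skew-symmetric in the pairs
`(γ, k)`, `(ε, l)`, in `Ω_{αj}^{iβ} = R_{αjkl}^{iβγε} ω_ε^l ∧ ω_γ^k`.
Arguments: `curvTensor A α i β j γ k ε l x`. -/
def curvTensor (α : a) (i : b) (β : a) (j : b) (γ : a) (k : b) (ε : a) (l : b)
    (x : Coord a b) : ℝ :=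
  (1 / 2) * curvForm A α i β j x (dual A ε l x) (dual A γ k x)

/-- The Ricci tensor `R_{jk}^{βγ} = R_{αjki}^{iβγα}` (summed over `i` and `α`). -/
def ricci (β γ : a) (j k : b) (x : Coord a b) : ℝ :=
  ∑ α, ∑ i, curvTensor A α i β j γ k α i x

end Forms

/-! ### Normalizations -/

/-- A local frame field adapted to the normalization `ν` of `U`, over local coordinates
`x ∈ O ⊆ ℝ^ρ` on the Grassmannian: the points `A_α(x)` span `p(x) ∈ U`, the points `A_i(x)` span
the normalizing subspace of `p(x)`, and `x ↦ p(x)` is a local coordinate system, that is, the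
forms `ω_α^i` are a basis of the 1-forms at every point of `O`. -/
structure AdaptedFrame (a b : Type) [Fintype a] [Fintype b] [DecidableEq a] [DecidableEq b]
    {V : Type*} [NormedAddCommGroup V] [NormedSpace ℝ V] [FiniteDimensional ℝ V]
    (U : Set (Submodule ℝ V)) (ν : Submodule ℝ V → Submodule ℝ V) where
  /-- the coordinate domain -/
  O : Set (Coord a b)
  /-- the frames -/
  A : Coord a b → Basis (a ⊕ b) ℝ V
  isOpen_O : IsOpen O
  smooth : ∀ ξ, ContDiffOn ℝ ∞ (fun x => A x ξ) O
  span_mem : ∀ x ∈ O, Submodule.span ℝ (range fun α => A x (Sum.inl α)) ∈ U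
  span_normalizing : ∀ x ∈ O, Submodule.span ℝ (range fun i => A x (Sum.inr i)) =
    ν (Submodule.span ℝ (range fun α => A x (Sum.inl α)))
  coframe : ∀ x ∈ O, (theta A x).IsInvertible

/-- `ν` is a (smooth) normalization of the open domain `U` of the Grassmannian of
`|a|`-dimensional linear subspaces: every `p ∈ U` has dimension `|a|`, `ν p` is complementary
to `p`, and near every `p ∈ U` there is a smooth adapted frame field.  Openness is with respect to
the quotient topology from the space of linearly independent families. -/
structure IsNormalization (a b : Type) [Fintype a] [Fintype b] [DecidableEq a] [DecidableEq b]
    {V : Type*} [NormedAddCommGroup V] [NormedSpace ℝ V] [FiniteDimensional ℝ V]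
    (U : Set (Submodule ℝ V)) (ν : Submodule ℝ V → Submodule ℝ V) : Prop where
  finrank_eq : ∀ p ∈ U, finrank ℝ p = Fintype.card a
  isOpen : IsOpen {c : a → V | LinearIndependent ℝ c ∧ Submodule.span ℝ (range c) ∈ U}
  finrank_normalizing : ∀ p ∈ U, finrank ℝ (ν p) = Fintype.card b
  isCompl : ∀ p ∈ U, IsCompl p (ν p)
  exists_frame : ∀ p ∈ U, ∃ F : AdaptedFrame a b U ν, ∃ x ∈ F.O,
    Submodule.span ℝ (range fun α => F.A x (Sum.inl α)) = p

/-- Harmonic normalization: `λ_{ij}^{αβ} = λ_{ji}^{βα}`. -/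
def IsHarmonic (a b : Type) [Fintype a] [Fintype b] [DecidableEq a] [DecidableEq b]
    {V : Type*} [NormedAddCommGroup V] [NormedSpace ℝ V] [FiniteDimensional ℝ V]
    (U : Set (Submodule ℝ V)) (ν : Submodule ℝ V → Submodule ℝ V) : Prop :=
  ∀ F : AdaptedFrame a b U ν, ∀ x ∈ F.O, ∀ α β i j,
    fundTensor F.A α β i j x = fundTensor F.A β α j i x

/-- Nondegenerate normalization: the matrix `(λ_{ij}^{αβ})`, whose rank is the rank of the
mapping `ν`, has the maximal rank `ρ`. -/
def IsNondegenerate (a b : Type) [Fintype a] [Fintype b] [DecidableEq a] [DecidableEq b]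
    {V : Type*} [NormedAddCommGroup V] [NormedSpace ℝ V] [FiniteDimensional ℝ V]
    (U : Set (Submodule ℝ V)) (ν : Submodule ℝ V → Submodule ℝ V) : Prop :=
  ∀ F : AdaptedFrame a b U ν, ∀ x ∈ F.O,
    (fundMatrix F.A x).rank = Fintype.card a * Fintype.card b

/-- The fundamental tensor is covariantly constant with respect to `Γ^ν`. -/
def IsCovariantlyConstant (a b : Type) [Fintype a] [Fintype b] [DecidableEq a] [DecidableEq b]
    {V : Type*} [NormedAddCommGroup V] [NormedSpace ℝ V] [FiniteDimensional ℝ V]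
    (U : Set (Submodule ℝ V)) (ν : Submodule ℝ V → Submodule ℝ V) : Prop :=
  ∀ F : AdaptedFrame a b U ν, ∀ x ∈ F.O, ∀ v α β i j, nablaFund F.A α β i j x v = 0

/-- The local expressions of the quadratic form `g` are those of one tensor on `U`: they agree
under every change of the local coordinates (`φ`) and of the adapted frames. -/
def MetricWellDefined (a b : Type) [Fintype a] [Fintype b] [DecidableEq a] [DecidableEq b]
    {V : Type*} [NormedAddCommGroup V] [NormedSpace ℝ V] [FiniteDimensional ℝ V]
    (U : Set (Submodule ℝ V)) (ν : Submodule ℝ V → Submodule ℝ V) : Prop :=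
  ∀ (F F' : AdaptedFrame a b U ν) (O : Set (Coord a b)) (φ : Coord a b → Coord a b),
    IsOpen O → O ⊆ F.O → MapsTo φ O F'.O → ContDiffOn ℝ ∞ φ O →
    (∀ x ∈ O, Submodule.span ℝ (range fun α => F'.A (φ x) (Sum.inl α)) =
      Submodule.span ℝ (range fun α => F.A x (Sum.inl α))) →
    ∀ x ∈ O, ∀ v w,
      metric F'.A (φ x) (fderiv ℝ φ x v) (fderiv ℝ φ x w) = metric F.A x v w

/-- Homogeneous normalized domain: the projective transformations that preserve `U` and the
normalization act transitively on `U`. -/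
def IsHomogeneous (U : Set (Submodule ℝ V)) (ν : Submodule ℝ V → Submodule ℝ V) : Prop :=
  ∀ p ∈ U, ∀ q ∈ U, ∃ T : V ≃ₗ[ℝ] V, p.map (T : V →ₗ[ℝ] V) = q ∧
    (∀ s, s.map (T : V →ₗ[ℝ] V) ∈ U ↔ s ∈ U) ∧
    ∀ s ∈ U, ν (s.map (T : V →ₗ[ℝ] V)) = (ν s).map (T : V →ₗ[ℝ] V)

/-! ### Pseudo-Riemannian metrics and their Levi-Civita connection, in local coordinates -/

section LeviCivita

variable {E : Type*} [NormedAddCommGroup E] [NormedSpace ℝ E]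

/-- A pseudo-Riemannian metric on the open set `O`. -/
structure IsPseudoRiemannian (O : Set E) (g : E → LinearMap.BilinForm ℝ E) : Prop where
  smooth : ∀ v w, ContDiffOn ℝ ∞ (fun x => g x v w) O
  symm : ∀ x ∈ O, (g x).IsSymm
  nondegenerate : ∀ x ∈ O, (g x).Nondegenerate

/-- `D` is the covariant derivative of an affine connection on the open set `O`. -/
structure IsAffineConnection (O : Set E) (D : (E → E) → (E → E) → E → E) : Prop where
  smooth : ∀ X Y, ContDiffOn ℝ ∞ X O → ContDiffOn ℝ ∞ Y O → ContDiffOn ℝ ∞ (D X Y) O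
  add_left : ∀ X X' Y, ContDiffOn ℝ ∞ X O → ContDiffOn ℝ ∞ X' O → ContDiffOn ℝ ∞ Y O →
    ∀ x ∈ O, D (X + X') Y x = D X Y x + D X' Y x
  smul_left : ∀ (f : E → ℝ) X Y, ContDiffOn ℝ ∞ f O → ContDiffOn ℝ ∞ X O → ContDiffOn ℝ ∞ Y O →
    ∀ x ∈ O, D (fun y => f y • X y) Y x = f x • D X Y x
  add_right : ∀ X Y Y', ContDiffOn ℝ ∞ X O → ContDiffOn ℝ ∞ Y O → ContDiffOn ℝ ∞ Y' O →
    ∀ x ∈ O, D X (Y + Y') x = D X Y x + D X Y' x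
  leibniz : ∀ (f : E → ℝ) X Y, ContDiffOn ℝ ∞ f O → ContDiffOn ℝ ∞ X O → ContDiffOn ℝ ∞ Y O →
    ∀ x ∈ O, D X (fun y => f y • Y y) x = fderiv ℝ f x (X x) • Y x + f x • D X Y x

/-- `D` is the Levi-Civita connection of `g` on the open set `O`: the affine connection that is
torsion-free and for which `g` is covariantly constant. -/
structure IsLeviCivita (O : Set E) (g : E → LinearMap.BilinForm ℝ E)
    (D : (E → E) → (E → E) → E → E) : Prop where
  connection : IsAffineConnection O D
  torsion_free : ∀ X Y, ContDiffOn ℝ ∞ X O → ContDiffOn ℝ ∞ Y O →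
    ∀ x ∈ O, D X Y x - D Y X x = VectorField.lieBracket ℝ X Y x
  metric : ∀ X Y Z, ContDiffOn ℝ ∞ X O → ContDiffOn ℝ ∞ Y O → ContDiffOn ℝ ∞ Z O →
    ∀ x ∈ O, fderiv ℝ (fun y => g y (Y y) (Z y)) x (X x)
      = g x (D X Y x) (Z x) + g x (Y x) (D X Z x)

end LeviCivita

/-! ### The polar normalization

The hyperquadric is given by a nondegenerate symmetric bilinear form `B` on `V`. -/

section Polar

variable (B : LinearMap.BilinForm ℝ V)

/-- The restriction of the quadratic form of the hyperquadric to a subspace. -/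
def restrictForm (p : Submodule ℝ V) : QuadraticForm ℝ p :=
  LinearMap.BilinMap.toQuadraticMap (B.restrict p)

/-- The domain of all subspaces that are located with respect to the hyperquadric in the same
manner as `p₀`: they have the dimension of `p₀`, are not tangent to the hyperquadric, and the
restrictions of the form to `p` and to the polar subspace of `p` have the same signatures as for
`p₀`. -/
def polarDomain (p₀ : Submodule ℝ V) : Set (Submodule ℝ V) :=
  {p | finrank ℝ p = finrank ℝ p₀ ∧ (B.restrict p).Nondegenerate ∧
    sigPos (restrictForm B p) = sigPos (restrictForm B p₀) ∧
    sigNeg (restrictForm B p) = sigNeg (restrictForm B p₀) ∧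
    sigPos (restrictForm B (B.orthogonal p)) = sigPos (restrictForm B (B.orthogonal p₀)) ∧
    sigNeg (restrictForm B (B.orthogonal p)) = sigNeg (restrictForm B (B.orthogonal p₀))}

/-- The polar normalization: `p` is sent to its polar subspace `p*`. -/
def polarMap : Submodule ℝ V → Submodule ℝ V := fun p => B.orthogonal p

variable (A : Coord a b → Basis (a ⊕ b) ℝ V)

/-- The Gram matrix `g_{αβ} = (A_α, A_β)`. -/
def gramP (x : Coord a b) : Matrix a a ℝ :=
  Matrix.of fun α β => B (A x (Sum.inl α)) (A x (Sum.inl β))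

/-- The inverse `g^{αβ}` of the Gram matrix `g_{αβ}`. -/
def gramInv (x : Coord a b) : Matrix a a ℝ := (gramP B A x)⁻¹

/-- The Gram matrix `g_{ij} = (A_i, A_j)`. -/
def gramN (x : Coord a b) : Matrix b b ℝ :=
  Matrix.of fun i j => B (A x (Sum.inr i)) (A x (Sum.inr j))

/-- The covariant curvature tensor `R_{ijkl}^{αβγε} = g^{αδ} g_{ih} R_{δjkl}^{hβγε}`.
Arguments: `curvLower B A α i β j γ k ε l x`. -/
def curvLower (α : a) (i : b) (β : a) (j : b) (γ : a) (k : b) (ε : a) (l : b)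
    (x : Coord a b) : ℝ :=
  ∑ δ, ∑ h, gramInv B A x α δ * gramN B A x i h * curvTensor A δ h β j γ k ε l x

end Polar

end

end Grassmann

namespace Grassmann

noncomputable section

variable {a b : Type} [Fintype a] [Fintype b] [DecidableEq a] [DecidableEq b]
variable {V : Type*} [NormedAddCommGroup V] [NormedSpace ℝ V] [FiniteDimensional ℝ V]

set_option linter.unusedSectionVars false

/-! Everything local comes from differentiating the conjugacy relation `(A_α, A_i) = 0`. It gives
`g_{αβ} ω_i^β + g_{ij} ω_α^j = 0` (`gramP_omega`), so that `λ_{ij}^{αβ} = -g^{αβ} g_{ij}`. Symmetry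
of the Gram matrices yields harmonicity, and `λ` is, up to sign, a Kronecker product of invertible
matrices, hence of full rank. In `d g_{αβ}` and `d g_{ij}` the mixed pairings vanish, so each
involves only the forms `ω_α^β`, respectively `ω_i^j`; this is exactly `∇λ = 0`.

The coframe `ω_α^i` takes values in `Hom(p, p*)`, and `Γ^ν` is built from the connections induced on
`p` and `p*` by the flat connection of `V`. The structure equations `dω_ξ^η = ω_ξ^ζ ∧ ω_ζ^η`, which
express the symmetry of second derivatives, make the torsion vanish and reduce the curvature to
terms quadratic in `ω_α^i` and `ω_i^α`, hence linear in `λ`. In the coframe the metric has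
components `λ`, so `∇λ = 0` says that it is parallel. Substituting `λ = -g^{αβ} g_{ij}` gives the
curvature tensor, and its contraction is the Einstein condition.

Independence of frames is seen on the projection `P` onto `p` along `ν(p)`: the metric equals `-½
tr(dP dP)`, and `P` does not depend on the frame.

The global statements rest on inertia indices. The positive and negative indices of `p` and `p*` add
up to those of `V`; each index is lower semicontinuous while their sum is bounded by the dimension,
which makes the domain open. Sylvester's law gives isometries `p → q` and `p* → q*`, whose direct
sum is an isometry of `V`, so the domain is homogeneous. Local frames come from the graph chart `A_α
+ x_α^i A_i` with explicit conjugate points. -/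

theorem contDiffOn_clm_inverse {X E F : Type*} [NormedAddCommGroup X] [NormedSpace ℝ X]
    [NormedAddCommGroup E] [NormedSpace ℝ E] [NormedAddCommGroup F] [NormedSpace ℝ F]
    [CompleteSpace E] {O : Set X} {f : X → E →L[ℝ] F} (hf : ContDiffOn ℝ ∞ f O)
    (hinv : ∀ x ∈ O, (f x).IsInvertible) : ContDiffOn ℝ ∞ (fun x => (f x).inverse) O := by
  intro x hx
  exact ((hinv x hx).contDiffAt_map_inverse).comp_contDiffWithinAt x (hf x hx)

/-- Coordinates with respect to a smooth field of bases are smooth. -/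
theorem contDiffOn_coord {X : Type*} [NormedAddCommGroup X] [NormedSpace ℝ X] {ι : Type}
    [Fintype ι] {A : X → Basis ι ℝ V} {O : Set X}
    (hA : ∀ ξ, ContDiffOn ℝ ∞ (fun x => A x ξ) O) (η : ι) :
    ContDiffOn ℝ ∞ (fun x => LinearMap.toContinuousLinearMap ((A x).coord η)) O := by
  -- `S x` sends coefficients to the corresponding combination of basis vectors. It is smooth in
  -- `x`, and the coordinate functionals are the components of its inverse.
  let S : X → (ι → ℝ) →L[ℝ] V := fun x =>
    ∑ ξ, (ContinuousLinearMap.proj (R := ℝ) (φ := fun _ : ι => ℝ) ξ).smulRight (A x ξ)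
  have hS : ContDiffOn ℝ ∞ S O := by
    refine ContDiffOn.sum fun ξ _ => ?_
    exact ((ContinuousLinearMap.smulRightL ℝ (ι → ℝ) V
      (ContinuousLinearMap.proj ξ)).contDiff).comp_contDiffOn (hA ξ)
  have hSe : ∀ x, S x = ((A x).equivFun.symm.toContinuousLinearEquiv : (ι → ℝ) →L[ℝ] V) := by
    intro x
    ext1 c
    simp [S, Basis.equivFun_symm_apply]
  have hinv := contDiffOn_clm_inverse hS fun x _ => ⟨_, (hSe x).symm⟩
  have := ContDiffOn.clm_comp (contDiffOn_const (c := ContinuousLinearMap.proj (R := ℝ)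
    (φ := fun _ : ι => ℝ) η)) hinv
  refine this.congr fun x _ => ?_
  ext v
  simp [hSe]

/-! ### Smoothness of frames and the structure equations -/

section Frame

variable {U : Set (Submodule ℝ V)} {ν : Submodule ℝ V → Submodule ℝ V}
variable (F : AdaptedFrame a b U ν) {x : Coord a b}

theorem AdaptedFrame.contDiffOn_omega (ξ η : a ⊕ b) : ContDiffOn ℝ ∞ (omega F.A ξ η) F.O :=
  (contDiffOn_coord F.smooth η).clm_comp
    ((F.smooth ξ).fderiv_of_isOpen F.isOpen_O (by simp))

theorem AdaptedFrame.differentiableAt_frame (hx : x ∈ F.O) (ξ : a ⊕ b) :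
    DifferentiableAt ℝ (fun y => F.A y ξ) x :=
  ((F.smooth ξ).contDiffAt (F.isOpen_O.mem_nhds hx)).differentiableAt (by simp)

theorem AdaptedFrame.differentiableAt_omega (hx : x ∈ F.O) (ξ η : a ⊕ b) :
    DifferentiableAt ℝ (omega F.A ξ η) x :=
  ((F.contDiffOn_omega ξ η).contDiffAt (F.isOpen_O.mem_nhds hx)).differentiableAt (by simp)

theorem AdaptedFrame.contDiffOn_theta : ContDiffOn ℝ ∞ (theta F.A) F.O :=
  contDiffOn_clm_apply.2 fun _ => contDiffOn_pi.2 fun α => contDiffOn_pi.2 fun i =>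
    (F.contDiffOn_omega (Sum.inl α) (Sum.inr i)).clm_apply contDiffOn_const

theorem AdaptedFrame.contDiffOn_theta_inverse :
    ContDiffOn ℝ ∞ (fun x => (theta F.A x).inverse) F.O :=
  contDiffOn_clm_inverse F.contDiffOn_theta F.coframe

theorem AdaptedFrame.contDiffOn_dual (α : a) (i : b) : ContDiffOn ℝ ∞ (dual F.A α i) F.O :=
  F.contDiffOn_theta_inverse.clm_apply contDiffOn_const

theorem AdaptedFrame.contDiffOn_fundTensor (α β : a) (i j : b) :
    ContDiffOn ℝ ∞ (fundTensor F.A α β i j) F.O :=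
  (F.contDiffOn_omega _ _).clm_apply (F.contDiffOn_dual _ _)

theorem theta_apply (A : Coord a b → Basis (a ⊕ b) ℝ V) (x v : Coord a b) (α : a) (i : b) :
    theta A x v α i = omega A (Sum.inl α) (Sum.inr i) x v := rfl

theorem AdaptedFrame.theta_inverse (hx : x ∈ F.O) (c : Coord a b) :
    theta F.A x ((theta F.A x).inverse c) = c := by
  obtain ⟨e, he⟩ := F.coframe x hx
  rw [← he]
  simp

theorem AdaptedFrame.inverse_theta (hx : x ∈ F.O) (v : Coord a b) :
    (theta F.A x).inverse (theta F.A x v) = v := by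
  obtain ⟨e, he⟩ := F.coframe x hx
  rw [← he]
  simp

theorem AdaptedFrame.theta_injective (hx : x ∈ F.O) : Function.Injective (theta F.A x) :=
  Function.LeftInverse.injective (F.inverse_theta hx)

theorem AdaptedFrame.omega_dual (hx : x ∈ F.O) (α β : a) (i j : b) :
    omega F.A (Sum.inl α) (Sum.inr i) x (dual F.A β j x) =
      (1 : Matrix a a ℝ) α β * (1 : Matrix b b ℝ) i j := by
  rw [← theta_apply, dual, F.theta_inverse hx]
  by_cases h : α = β
  · subst h
    simp [Matrix.one_apply, Pi.single_apply]
  · simp [h]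

/-- Every tangent vector is the combination of the dual vectors with the values of the basis
forms as coefficients. -/
theorem AdaptedFrame.eq_sum_dual (hx : x ∈ F.O) (v : Coord a b) :
    v = ∑ α, ∑ i, omega F.A (Sum.inl α) (Sum.inr i) x v • dual F.A α i x := by
  apply F.theta_injective hx
  ext α i
  simp [theta_apply, F.omega_dual hx, Matrix.one_apply]

theorem fderiv_frame (A : Coord a b → Basis (a ⊕ b) ℝ V) (ξ : a ⊕ b) (x v : Coord a b) :
    fderiv ℝ (fun y => A y ξ) x v = ∑ η, omega A ξ η x v • A x η :=
  ((A x).sum_repr _).symm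

/-- The structure equations `d ω_ξ^η = ∑ ω_ξ^ζ ∧ ω_ζ^η` of the projective space. -/
theorem AdaptedFrame.extDerivOne_omega (hx : x ∈ F.O) (ξ η : a ⊕ b) (v w : Coord a b) :
    extDerivOne (omega F.A ξ η) x v w =
      ∑ ζ, (omega F.A ξ ζ x v * omega F.A ζ η x w - omega F.A ξ ζ x w * omega F.A ζ η x v) := by
  have hO := F.isOpen_O.mem_nhds hx
  -- Expanding `dA_ξ = ω_ξ^ζ A_ζ` and differentiating once more writes the second derivative of
  -- `A_ξ` in the frame. The `η` coordinate of its symmetry is the structure equation.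
  have key : ∀ v w : Coord a b, fderiv ℝ (fderiv ℝ fun y => F.A y ξ) x v w =
      ∑ ζ, (fderiv ℝ (omega F.A ξ ζ) x v w • F.A x ζ +
        omega F.A ξ ζ x w • ∑ η, omega F.A ζ η x v • F.A x η) := by
    intro v w
    have h1 : fderiv ℝ (fderiv ℝ fun y => F.A y ξ) x v w =
        fderiv ℝ (fun y => fderiv ℝ (fun z => F.A z ξ) y w) x v := by
      have hd : DifferentiableAt ℝ (fderiv ℝ fun y => F.A y ξ) x :=
        (((F.smooth ξ).fderiv_of_isOpen (m := ∞) F.isOpen_O (by simp)).contDiffAt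
          hO).differentiableAt (by simp)
      rw [fderiv_clm_apply hd (differentiableAt_const w)]
      simp
    rw [h1]
    simp_rw [fderiv_frame]
    rw [fderiv_fun_sum (A := fun ζ y => omega F.A ξ ζ y w • F.A y ζ)
      fun ζ _ => ((F.differentiableAt_omega hx ξ ζ).clm_apply
      (differentiableAt_const w)).smul (F.differentiableAt_frame hx ζ)]
    rw [sum_apply]
    refine Finset.sum_congr rfl fun ζ _ => ?_
    rw [fderiv_fun_smul ((F.differentiableAt_omega hx ξ ζ).clm_apply
      (differentiableAt_const w)) (F.differentiableAt_frame hx ζ),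
      fderiv_clm_apply (F.differentiableAt_omega hx ξ ζ) (differentiableAt_const w)]
    simp [fderiv_frame, add_comm]
  have hsymm : fderiv ℝ (fderiv ℝ fun y => F.A y ξ) x v w =
      fderiv ℝ (fderiv ℝ fun y => F.A y ξ) x w v :=
    (((F.smooth ξ).contDiffAt hO).isSymmSndFDerivAt
      (by simpa using WithTop.coe_le_coe.2 (le_top : (2 : ℕ∞) ≤ ⊤))) v w
  rw [key, key] at hsymm
  have := congrArg (fun u => (F.A x).coord η u) hsymm
  simp only [Finset.sum_add_distrib, map_add, map_sum, map_smul, Basis.coord_apply,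
    Basis.repr_self, Finsupp.single_apply, smul_eq_mul, mul_ite, mul_one, mul_zero,
    Finset.sum_ite_eq', Finset.mem_univ, if_true] at this
  rw [extDerivOne, Finset.sum_sub_distrib]
  linarith

end Frame

/-! ### Gram matrices and the fundamental tensor of the polar normalization -/

section PolarFrame

variable {U : Set (Submodule ℝ V)} {B : LinearMap.BilinForm ℝ V}
variable (F : AdaptedFrame a b U (polarMap B)) {x : Coord a b}

theorem AdaptedFrame.polar_inl_inr (hx : x ∈ F.O) (α : a) (i : b) :
    B (F.A x (Sum.inl α)) (F.A x (Sum.inr i)) = 0 := by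
  have h : F.A x (Sum.inr i) ∈ Submodule.span ℝ (range fun i => F.A x (Sum.inr i)) :=
    Submodule.subset_span ⟨i, rfl⟩
  rw [F.span_normalizing x hx] at h
  exact h _ (Submodule.subset_span ⟨α, rfl⟩)

theorem AdaptedFrame.polar_inr_inl (hB : B.IsSymm) (hx : x ∈ F.O) (α : a) (i : b) :
    B (F.A x (Sum.inr i)) (F.A x (Sum.inl α)) = 0 := by
  rw [hB.eq_iff]
  exact F.polar_inl_inr hx α i

theorem AdaptedFrame.fderiv_bilin (hx : x ∈ F.O) (ξ η : a ⊕ b) (v : Coord a b) :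
    fderiv ℝ (fun y => B (F.A y ξ) (F.A y η)) x v =
      (∑ ζ, omega F.A ξ ζ x v * B (F.A x ζ) (F.A x η)) +
        ∑ ζ, omega F.A η ζ x v * B (F.A x ξ) (F.A x ζ) := by
  have h := B.toContinuousBilinearMap.hasFDerivAt_of_bilinear
    (F.differentiableAt_frame hx ξ).hasFDerivAt (F.differentiableAt_frame hx η).hasFDerivAt
  have h' : HasFDerivAt (fun y => B (F.A y ξ) (F.A y η)) _ x := h
  rw [h'.fderiv]
  simp [fderiv_frame, add_comm]

theorem gramP_apply (A : Coord a b → Basis (a ⊕ b) ℝ V) (x : Coord a b) (α β : a) :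
    gramP B A x α β = B (A x (Sum.inl α)) (A x (Sum.inl β)) := rfl

theorem gramN_apply (A : Coord a b → Basis (a ⊕ b) ℝ V) (x : Coord a b) (i j : b) :
    gramN B A x i j = B (A x (Sum.inr i)) (A x (Sum.inr j)) := rfl

theorem gramP_symm (hB : B.IsSymm) (A : Coord a b → Basis (a ⊕ b) ℝ V) (x : Coord a b)
    (α β : a) : gramP B A x α β = gramP B A x β α := hB.eq _ _

theorem gramN_symm (hB : B.IsSymm) (A : Coord a b → Basis (a ⊕ b) ℝ V) (x : Coord a b)
    (i j : b) : gramN B A x i j = gramN B A x j i := hB.eq _ _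

theorem gramInv_symm (hB : B.IsSymm) (A : Coord a b → Basis (a ⊕ b) ℝ V) (x : Coord a b)
    (α β : a) : gramInv B A x α β = gramInv B A x β α := by
  have : (gramP B A x).transpose = gramP B A x := Matrix.ext fun α β => gramP_symm hB A x β α
  have h := congrFun (congrFun (Matrix.transpose_nonsing_inv (gramP B A x)) β) α
  rw [this] at h
  exact h

theorem AdaptedFrame.fderiv_gramP (hB : B.IsSymm) (hx : x ∈ F.O) (α β : a) (v : Coord a b) :
    fderiv ℝ (fun y => gramP B F.A y α β) x v =
      (∑ γ, omega F.A (Sum.inl α) (Sum.inl γ) x v * gramP B F.A x γ β) +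
        ∑ γ, omega F.A (Sum.inl β) (Sum.inl γ) x v * gramP B F.A x α γ := by
  have := F.fderiv_bilin (B := B) hx (Sum.inl α) (Sum.inl β) v
  simpa [Fintype.sum_sum_type, F.polar_inl_inr hx, F.polar_inr_inl hB hx, gramP_apply,
    gramN_apply] using this

theorem AdaptedFrame.fderiv_gramN (hB : B.IsSymm) (hx : x ∈ F.O) (i j : b) (v : Coord a b) :
    fderiv ℝ (fun y => gramN B F.A y i j) x v =
      (∑ k, omega F.A (Sum.inr i) (Sum.inr k) x v * gramN B F.A x k j) +
        ∑ k, omega F.A (Sum.inr j) (Sum.inr k) x v * gramN B F.A x i k := by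
  have := F.fderiv_bilin (B := B) hx (Sum.inr i) (Sum.inr j) v
  simpa [Fintype.sum_sum_type, F.polar_inl_inr hx, F.polar_inr_inl hB hx, gramP_apply,
    gramN_apply] using this

/-- This is the derivative of `(A_α, A_i) = 0`, which holds on the whole open set `O`. It ties
`ω_i^α` to `ω_α^i` and carries all the later computations. -/
theorem AdaptedFrame.gramP_omega (hB : B.IsSymm) (hx : x ∈ F.O) (α : a) (i : b)
    (v : Coord a b) :
    ∑ β, gramP B F.A x α β * omega F.A (Sum.inr i) (Sum.inl β) x v =
      -∑ j, gramN B F.A x i j * omega F.A (Sum.inl α) (Sum.inr j) x v := by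
  have h := F.fderiv_bilin (B := B) hx (Sum.inl α) (Sum.inr i) v
  have h0 : (fun y => B (F.A y (Sum.inl α)) (F.A y (Sum.inr i))) =ᶠ[nhds x] fun _ => 0 := by
    filter_upwards [F.isOpen_O.mem_nhds hx] with y hy using F.polar_inl_inr hy α i
  rw [h0.fderiv_eq] at h
  simp [Fintype.sum_sum_type, F.polar_inl_inr hx] at h
  simp_rw [gramP_apply, gramN_symm hB _ _ i, gramN_apply, mul_comm (B _ _)]
  linarith

/-- Conjugacy makes the matrix of the form in the frame block diagonal, so its nonzero determinant
is the product of the two Gram determinants. -/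
theorem AdaptedFrame.isUnit_det_gram (hB : B.IsSymm) (hBn : B.Nondegenerate) (hx : x ∈ F.O) :
    IsUnit (gramP B F.A x).det ∧ IsUnit (gramN B F.A x).det := by
  have h := (LinearMap.BilinForm.nondegenerate_iff_det_ne_zero (F.A x)).1 hBn
  have hM : LinearMap.BilinForm.toMatrix (F.A x) B =
      Matrix.fromBlocks (gramP B F.A x) 0 0 (gramN B F.A x) := by
    ext (α | i) (β | j) <;>
      simp [LinearMap.BilinForm.toMatrix_apply, gramP_apply, gramN_apply, F.polar_inl_inr hx,
        F.polar_inr_inl hB hx]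
  rw [hM, Matrix.det_fromBlocks_zero₂₁] at h
  exact ⟨(left_ne_zero_of_mul h).isUnit, (right_ne_zero_of_mul h).isUnit⟩

theorem AdaptedFrame.gramInv_gramP (hB : B.IsSymm) (hBn : B.Nondegenerate) (hx : x ∈ F.O)
    (α γ : a) : ∑ β, gramInv B F.A x α β * gramP B F.A x β γ = (1 : Matrix a a ℝ) α γ := by
  rw [← Matrix.nonsing_inv_mul _ (F.isUnit_det_gram hB hBn hx).1]
  rfl

theorem AdaptedFrame.gramP_gramInv (hB : B.IsSymm) (hBn : B.Nondegenerate) (hx : x ∈ F.O)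
    (α γ : a) : ∑ β, gramP B F.A x α β * gramInv B F.A x β γ = (1 : Matrix a a ℝ) α γ := by
  rw [← Matrix.mul_nonsing_inv _ (F.isUnit_det_gram hB hBn hx).1]
  rfl

theorem AdaptedFrame.omega_inr_inl (hB : B.IsSymm) (hBn : B.Nondegenerate) (hx : x ∈ F.O)
    (v : Coord a b) (α : a) (i : b) :
    omega F.A (Sum.inr i) (Sum.inl α) x v =
      -∑ β, ∑ j, gramInv B F.A x α β * gramN B F.A x i j *
        omega F.A (Sum.inl β) (Sum.inr j) x v := by
  have h1 : ∀ β, ∑ j, gramInv B F.A x α β * gramN B F.A x i j *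
      omega F.A (Sum.inl β) (Sum.inr j) x v = -∑ γ, gramInv B F.A x α β * gramP B F.A x β γ *
        omega F.A (Sum.inr i) (Sum.inl γ) x v := by
    intro β
    simp_rw [mul_assoc, ← Finset.mul_sum, F.gramP_omega hB hx]
    ring
  simp_rw [h1, Finset.sum_neg_distrib, neg_neg]
  rw [Finset.sum_comm]
  simp_rw [← Finset.sum_mul, F.gramInv_gramP hB hBn hx]
  simp [Matrix.one_apply]

theorem AdaptedFrame.fundTensor_eq (hB : B.IsSymm) (hBn : B.Nondegenerate) (hx : x ∈ F.O)
    (α β : a) (i j : b) :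
    fundTensor F.A α β i j x = -(gramInv B F.A x α β * gramN B F.A x i j) := by
  rw [fundTensor, F.omega_inr_inl hB hBn hx]
  simp [F.omega_dual hx, Matrix.one_apply]

theorem AdaptedFrame.fundTensor_symm (hB : B.IsSymm) (hBn : B.Nondegenerate) (hx : x ∈ F.O)
    (α β : a) (i j : b) : fundTensor F.A α β i j x = fundTensor F.A β α j i x := by
  rw [F.fundTensor_eq hB hBn hx, F.fundTensor_eq hB hBn hx, gramInv_symm hB, gramN_symm hB]

theorem isHarmonic_polarMap (hB : B.IsSymm) (hBn : B.Nondegenerate) :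
    IsHarmonic a b U (polarMap B) :=
  fun F _ hx _ _ _ _ => F.fundTensor_symm hB hBn hx _ _ _ _

/-- The fundamental matrix is the Kronecker product of two invertible matrices, `-(g^{αβ})` and
`(g_{ij})`. -/
theorem isNondegenerate_polarMap (hB : B.IsSymm) (hBn : B.Nondegenerate) :
    IsNondegenerate a b U (polarMap B) := by
  intro F x hx
  have h : fundMatrix F.A x =
      Matrix.kroneckerMap (· * ·) (-gramInv B F.A x) (gramN B F.A x) := by
    ext ⟨α, i⟩ ⟨β, j⟩
    simp [fundMatrix, F.fundTensor_eq hB hBn hx]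
  obtain ⟨hP, hN⟩ := F.isUnit_det_gram hB hBn hx
  rw [Matrix.rank_of_isUnit, Fintype.card_prod]
  rw [Matrix.isUnit_iff_isUnit_det, h, Matrix.det_kronecker, Matrix.det_neg]
  have : IsUnit (gramInv B F.A x).det := Matrix.isUnit_nonsing_inv_det _ hP
  exact (((isUnit_one.neg.pow _).mul this).pow _).mul (hN.pow _)

/-- To avoid differentiating the inverse matrix `g^{αβ}`, the relation `g_{αγ} λ_{ij}^{γβ} = -δ_α^β
g_{ij}` is differentiated, the Gram derivatives being known. This gives `g_{αγ} ∇λ_{ij}^{γβ} = 0`,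
and the Gram matrix is then inverted. -/
theorem AdaptedFrame.nablaFund_eq_zero (hB : B.IsSymm) (hBn : B.Nondegenerate) (hx : x ∈ F.O)
    (v : Coord a b) (α β : a) (i j : b) : nablaFund F.A α β i j x v = 0 := by
  have hO := F.isOpen_O.mem_nhds hx
  have hrel : ∀ y ∈ F.O, ∀ α i j, ∑ γ, gramP B F.A y α γ * fundTensor F.A γ β i j y =
      -((1 : Matrix a a ℝ) α β * gramN B F.A y i j) := by
    intro y hy α i j
    simp_rw [F.fundTensor_eq hB hBn hy, mul_neg, Finset.sum_neg_distrib, ← mul_assoc,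
      ← Finset.sum_mul, F.gramP_gramInv hB hBn hy]
  have hdP : ∀ α γ, DifferentiableAt ℝ (fun y => gramP B F.A y α γ) x := fun α γ =>
    (B.toContinuousBilinearMap.hasFDerivAt_of_bilinear
      (F.differentiableAt_frame hx _).hasFDerivAt
      (F.differentiableAt_frame hx _).hasFDerivAt).differentiableAt
  have hdN : DifferentiableAt ℝ (fun y => gramN B F.A y i j) x :=
    (B.toContinuousBilinearMap.hasFDerivAt_of_bilinear
      (F.differentiableAt_frame hx _).hasFDerivAt
      (F.differentiableAt_frame hx _).hasFDerivAt).differentiableAt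
  have hdL : ∀ γ, DifferentiableAt ℝ (fundTensor F.A γ β i j) x := fun γ =>
    ((F.contDiffOn_fundTensor γ β i j).contDiffAt hO).differentiableAt (by simp)
  have hder : ∀ α, ∑ γ, gramP B F.A x α γ * nablaFund F.A γ β i j x v = 0 := by
    intro α
    have h1 : fderiv ℝ (fun y => ∑ γ, gramP B F.A y α γ * fundTensor F.A γ β i j y) x v =
        ∑ γ, (gramP B F.A x α γ * fderiv ℝ (fundTensor F.A γ β i j) x v +
          fundTensor F.A γ β i j x * ((∑ δ, omega F.A (Sum.inl α) (Sum.inl δ) x v *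
            gramP B F.A x δ γ) +
          ∑ δ, omega F.A (Sum.inl γ) (Sum.inl δ) x v * gramP B F.A x α δ)) := by
      rw [fderiv_fun_sum (A := fun γ y => gramP B F.A y α γ * fundTensor F.A γ β i j y)
        fun γ _ => (hdP α γ).mul (hdL γ), sum_apply]
      refine Finset.sum_congr rfl fun γ _ => ?_
      rw [fderiv_fun_mul (hdP α γ) (hdL γ), ← F.fderiv_gramP hB hx]
      simp
    have h2 : fderiv ℝ (fun y => ∑ γ, gramP B F.A y α γ * fundTensor F.A γ β i j y) x v =
        -((1 : Matrix a a ℝ) α β * ((∑ k, omega F.A (Sum.inr i) (Sum.inr k) x v *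
          gramN B F.A x k j) + ∑ k, omega F.A (Sum.inr j) (Sum.inr k) x v *
            gramN B F.A x i k)) := by
      have : (fun y => ∑ γ, gramP B F.A y α γ * fundTensor F.A γ β i j y) =ᶠ[nhds x]
          fun y => -((1 : Matrix a a ℝ) α β * gramN B F.A y i j) := by
        filter_upwards [hO] with y hy using hrel y hy α i j
      rw [this.fderiv_eq, fderiv_fun_neg, fderiv_const_mul hdN, ← F.fderiv_gramN hB hx]
      simp
    rw [h1] at h2
    -- The connection terms of the contracted `∇λ` are matched with those of the differentiated
    -- relation: `e1` with `e3` and the two sides of `e4` for the indices of `p`, and `e2`, used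
    -- once for each lower index, for those of `p*`.
    have e1 : ∑ γ, fundTensor F.A γ β i j x * ∑ δ, omega F.A (Sum.inl α) (Sum.inl δ) x v *
        gramP B F.A x δ γ = -(omega F.A (Sum.inl α) (Sum.inl β) x v * gramN B F.A x i j) := by
      have : ∀ δ, ∑ γ, fundTensor F.A γ β i j x * (omega F.A (Sum.inl α) (Sum.inl δ) x v *
          gramP B F.A x δ γ) = omega F.A (Sum.inl α) (Sum.inl δ) x v *
            -((1 : Matrix a a ℝ) δ β * gramN B F.A x i j) := by
        intro δ
        rw [← hrel x hx, Finset.mul_sum]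
        exact Finset.sum_congr rfl fun _ _ => by ring
      simp_rw [Finset.mul_sum]
      rw [Finset.sum_comm]
      simp_rw [this]
      simp [Matrix.one_apply]
    have e2 : ∀ f : b → ℝ, ∀ c : b → b × b, ∑ γ, gramP B F.A x α γ *
        ∑ k, fundTensor F.A γ β (c k).1 (c k).2 x * f k =
          -((1 : Matrix a a ℝ) α β * ∑ k, f k * gramN B F.A x (c k).1 (c k).2) := by
      intro f c
      simp_rw [Finset.mul_sum]
      rw [Finset.sum_comm, ← Finset.sum_neg_distrib]
      refine Finset.sum_congr rfl fun k _ => ?_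
      simp_rw [← mul_assoc, ← Finset.sum_mul, hrel x hx]
      ring
    have e3 : ∑ γ, gramP B F.A x α γ * ∑ δ, fundTensor F.A γ δ i j x *
        omega F.A (Sum.inl δ) (Sum.inl β) x v =
          -(omega F.A (Sum.inl α) (Sum.inl β) x v * gramN B F.A x i j) := by
      simp_rw [Finset.mul_sum, F.fundTensor_eq hB hBn hx]
      rw [Finset.sum_comm]
      have : ∀ δ, ∑ γ, gramP B F.A x α γ * (-(gramInv B F.A x γ δ * gramN B F.A x i j) *
          omega F.A (Sum.inl δ) (Sum.inl β) x v) = (1 : Matrix a a ℝ) α δ *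
            -(gramN B F.A x i j * omega F.A (Sum.inl δ) (Sum.inl β) x v) := by
        intro δ
        rw [← F.gramP_gramInv hB hBn hx, Finset.sum_mul]
        exact Finset.sum_congr rfl fun _ _ => by ring
      simp_rw [this]
      simp [Matrix.one_apply, mul_comm]
    have e4 : ∑ γ, gramP B F.A x α γ * ∑ δ, fundTensor F.A δ β i j x *
        omega F.A (Sum.inl δ) (Sum.inl γ) x v = ∑ γ, fundTensor F.A γ β i j x *
          ∑ δ, omega F.A (Sum.inl γ) (Sum.inl δ) x v * gramP B F.A x α δ := by
      simp_rw [Finset.mul_sum]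
      rw [Finset.sum_comm]
      exact Finset.sum_congr rfl fun _ _ => Finset.sum_congr rfl fun _ _ => by ring
    have e5 := e2 (fun k => omega F.A (Sum.inr j) (Sum.inr k) x v) fun k => (i, k)
    have e6 := e2 (fun k => omega F.A (Sum.inr i) (Sum.inr k) x v) fun k => (k, j)
    simp only [nablaFund, mul_add, mul_sub, Finset.sum_add_distrib, Finset.sum_sub_distrib]
      at h2 ⊢
    rw [e1] at h2
    rw [e3, e4]
    dsimp only at e5 e6
    rw [e5, e6]
    linarith
  calc nablaFund F.A α β i j x v
      = ∑ γ, (1 : Matrix a a ℝ) α γ * nablaFund F.A γ β i j x v := by simp [Matrix.one_apply]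
    _ = ∑ δ, gramInv B F.A x α δ * ∑ γ, gramP B F.A x δ γ * nablaFund F.A γ β i j x v := by
        simp_rw [← F.gramInv_gramP hB hBn hx, Finset.sum_mul, Finset.mul_sum, mul_assoc]
        exact Finset.sum_comm
    _ = 0 := by simp [hder]

theorem isCovariantlyConstant_polarMap (hB : B.IsSymm) (hBn : B.Nondegenerate) :
    IsCovariantlyConstant a b U (polarMap B) :=
  fun F _ hx _ _ _ _ _ => F.nablaFund_eq_zero hB hBn hx _ _ _ _ _

end PolarFrame

/-! ### Metric and curvature in terms of the fundamental tensor -/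

section Curvature

variable {U : Set (Submodule ℝ V)} {ν : Submodule ℝ V → Submodule ℝ V}
variable (F : AdaptedFrame a b U ν) {x : Coord a b}

/-- The defining relation `ω_i^α = λ_{ij}^{αβ} ω_β^j` of the fundamental tensor. -/
theorem AdaptedFrame.omega_inr_inl_eq_fundTensor (hx : x ∈ F.O) (v : Coord a b) (α : a) (i : b) :
    omega F.A (Sum.inr i) (Sum.inl α) x v =
      ∑ β, ∑ j, fundTensor F.A α β i j x * omega F.A (Sum.inl β) (Sum.inr j) x v := by
  conv_lhs => rw [F.eq_sum_dual hx v]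
  simp [fundTensor, mul_comm]

theorem metric_apply (A : Coord a b → Basis (a ⊕ b) ℝ V) (x v w : Coord a b) :
    metric A x v w = (1 / 2) * ∑ α, ∑ i,
      (omega A (Sum.inr i) (Sum.inl α) x v * omega A (Sum.inl α) (Sum.inr i) x w +
        omega A (Sum.inl α) (Sum.inr i) x v * omega A (Sum.inr i) (Sum.inl α) x w) := by
  simp [metric, LinearMap.sum_apply]

/-- Each half of the symmetrized product expands to a sum with coefficients `λ`, the two differing
by the exchange of `(α, i)` and `(β, j)`; harmonicity identifies them. -/
theorem AdaptedFrame.metric_eq_fundTensor (hx : x ∈ F.O)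
    (hsymm : ∀ α β i j, fundTensor F.A α β i j x = fundTensor F.A β α j i x)
    (v w : Coord a b) :
    metric F.A x v w = ∑ α, ∑ i, ∑ β, ∑ j, fundTensor F.A α β i j x *
      omega F.A (Sum.inl α) (Sum.inr i) x v * omega F.A (Sum.inl β) (Sum.inr j) x w := by
  have h1 : ∑ α, ∑ i, omega F.A (Sum.inl α) (Sum.inr i) x v *
      omega F.A (Sum.inr i) (Sum.inl α) x w = ∑ α, ∑ i, ∑ β, ∑ j, fundTensor F.A α β i j x *
      omega F.A (Sum.inl α) (Sum.inr i) x v * omega F.A (Sum.inl β) (Sum.inr j) x w := by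
    simp_rw [F.omega_inr_inl_eq_fundTensor hx, Finset.mul_sum]
    exact Finset.sum_congr rfl fun _ _ => Finset.sum_congr rfl fun _ _ =>
      Finset.sum_congr rfl fun _ _ => Finset.sum_congr rfl fun _ _ => by ring
  have h2 : ∑ α, ∑ i, omega F.A (Sum.inr i) (Sum.inl α) x v *
      omega F.A (Sum.inl α) (Sum.inr i) x w = ∑ α, ∑ i, ∑ β, ∑ j, fundTensor F.A α β i j x *
      omega F.A (Sum.inl α) (Sum.inr i) x v * omega F.A (Sum.inl β) (Sum.inr j) x w := by
    have hcomm : ∀ f : a → b → a → b → ℝ, ∑ α, ∑ i, ∑ β, ∑ j, f α i β j =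
        ∑ α, ∑ i, ∑ β, ∑ j, f β j α i := by
      intro f
      have := Finset.sum_comm (s := Finset.univ) (t := Finset.univ)
        (f := fun p q : a × b => f p.1 p.2 q.1 q.2)
      simpa only [Fintype.sum_prod_type] using this
    simp_rw [F.omega_inr_inl_eq_fundTensor hx, Finset.sum_mul]
    rw [hcomm]
    simp_rw [hsymm]
  rw [metric_apply]
  simp_rw [Finset.sum_add_distrib]
  rw [h1, h2]
  ring

/-- Both factors have the shape `1 ⊗ P - Q ⊗ 1`. In the curvature the two mixed terms together are
symmetric in the two tangent vectors, so they disappear on antisymmetrization. -/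
theorem sum_connForm_mul (P R : b → ℝ) (Q S : a → ℝ) (α β : a) (i j : b) :
    ∑ γ, ∑ k, ((1 : Matrix a a ℝ) α γ * P k - (1 : Matrix b b ℝ) k i * Q γ) *
        ((1 : Matrix a a ℝ) γ β * R k - (1 : Matrix b b ℝ) j k * S γ) =
      (1 : Matrix a a ℝ) α β * (∑ k, P k * R k) - P j * S α - Q β * R i +
        (1 : Matrix b b ℝ) j i * ∑ γ, Q γ * S γ := by
  have h : ∀ γ k, ((1 : Matrix a a ℝ) α γ * P k - (1 : Matrix b b ℝ) k i * Q γ) *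
        ((1 : Matrix a a ℝ) γ β * R k - (1 : Matrix b b ℝ) j k * S γ) =
      (1 : Matrix a a ℝ) α γ * ((1 : Matrix a a ℝ) γ β * (P k * R k)) -
      (1 : Matrix a a ℝ) α γ * ((1 : Matrix b b ℝ) j k * (P k * S γ)) -
      (1 : Matrix a a ℝ) γ β * ((1 : Matrix b b ℝ) k i * (Q γ * R k)) +
      (1 : Matrix b b ℝ) j k * ((1 : Matrix b b ℝ) k i * (Q γ * S γ)) := fun γ k => by ring
  simp_rw [h, Finset.sum_add_distrib, Finset.sum_sub_distrib, ← Finset.mul_sum]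
  simp [Matrix.one_apply, Finset.mul_sum]

theorem AdaptedFrame.extDerivOne_connForm (hx : x ∈ F.O) (α β : a) (i j : b)
    (v w : Coord a b) :
    extDerivOne (connForm F.A α i β j) x v w =
      (1 : Matrix a a ℝ) α β * extDerivOne (omega F.A (Sum.inr j) (Sum.inr i)) x v w -
        (1 : Matrix b b ℝ) j i * extDerivOne (omega F.A (Sum.inl α) (Sum.inl β)) x v w := by
  have h : fderiv ℝ (connForm F.A α i β j) x =
      (1 : Matrix a a ℝ) α β • fderiv ℝ (omega F.A (Sum.inr j) (Sum.inr i)) x -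
        (1 : Matrix b b ℝ) j i • fderiv ℝ (omega F.A (Sum.inl α) (Sum.inl β)) x :=
    (((F.differentiableAt_omega hx (Sum.inr j) (Sum.inr i)).hasFDerivAt.const_smul
      ((1 : Matrix a a ℝ) α β)).sub ((F.differentiableAt_omega hx (Sum.inl α)
        (Sum.inl β)).hasFDerivAt.const_smul ((1 : Matrix b b ℝ) j i))).fderiv
  simp only [extDerivOne, h, sub_apply, smul_apply, smul_eq_mul]
  ring

theorem connForm_apply (A : Coord a b → Basis (a ⊕ b) ℝ V) (x v : Coord a b) (α β : a)
    (i j : b) : connForm A α i β j x v =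
      (1 : Matrix a a ℝ) α β * omega A (Sum.inr j) (Sum.inr i) x v -
        (1 : Matrix b b ℝ) j i * omega A (Sum.inl α) (Sum.inl β) x v := rfl

/-- `Ω_{αj}^{iβ} = δ_α^β ω_j^γ ∧ ω_γ^i - δ_j^i ω_α^k ∧ ω_k^β`. -/
theorem AdaptedFrame.curvForm_eq (hx : x ∈ F.O) (α β : a) (i j : b) (v w : Coord a b) :
    curvForm F.A α i β j x v w =
      (1 : Matrix a a ℝ) α β * (∑ γ,
        (omega F.A (Sum.inr j) (Sum.inl γ) x v * omega F.A (Sum.inl γ) (Sum.inr i) x w -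
          omega F.A (Sum.inr j) (Sum.inl γ) x w * omega F.A (Sum.inl γ) (Sum.inr i) x v)) -
      (1 : Matrix b b ℝ) j i * ∑ k,
        (omega F.A (Sum.inl α) (Sum.inr k) x v * omega F.A (Sum.inr k) (Sum.inl β) x w -
          omega F.A (Sum.inl α) (Sum.inr k) x w * omega F.A (Sum.inr k) (Sum.inl β) x v) := by
  rw [curvForm, F.extDerivOne_connForm hx, F.extDerivOne_omega hx, F.extDerivOne_omega hx]
  simp_rw [connForm_apply, Finset.sum_sub_distrib]
  rw [sum_connForm_mul (fun k => omega F.A (Sum.inr k) (Sum.inr i) x v)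
      (fun k => omega F.A (Sum.inr j) (Sum.inr k) x w)
      (fun γ => omega F.A (Sum.inl α) (Sum.inl γ) x v)
      (fun γ => omega F.A (Sum.inl γ) (Sum.inl β) x w),
    sum_connForm_mul (fun k => omega F.A (Sum.inr k) (Sum.inr i) x w)
      (fun k => omega F.A (Sum.inr j) (Sum.inr k) x v)
      (fun γ => omega F.A (Sum.inl α) (Sum.inl γ) x w)
      (fun γ => omega F.A (Sum.inl γ) (Sum.inl β) x v)]
  -- The terms `ω_j^k ∧ ω_k^i` and `ω_α^γ ∧ ω_γ^β` of the structure equations cancel against the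
  -- quadratic part. Only the products passing through the opposite index range remain.
  simp only [Fintype.sum_sum_type,
    mul_comm (omega F.A (Sum.inr _) (Sum.inr i) x _) (omega F.A (Sum.inr j) (Sum.inr _) x _)]
  ring

theorem AdaptedFrame.curvTensor_eq (hx : x ∈ F.O) (α β γ ε : a) (i j k l : b) :
    curvTensor F.A α i β j γ k ε l x = (1 / 2) *
      ((1 : Matrix a a ℝ) α β * (fundTensor F.A γ ε j l x * (1 : Matrix b b ℝ) i k -
          fundTensor F.A ε γ j k x * (1 : Matrix b b ℝ) i l) -
        (1 : Matrix b b ℝ) j i * ((1 : Matrix a a ℝ) α ε * fundTensor F.A β γ l k x -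
          (1 : Matrix a a ℝ) α γ * fundTensor F.A β ε k l x)) := by
  rw [curvTensor, F.curvForm_eq hx]
  have h : ∀ α β i j, omega F.A (Sum.inr i) (Sum.inl α) x (dual F.A β j x) =
    fundTensor F.A α β i j x := fun _ _ _ _ => rfl
  simp only [h, F.omega_dual hx]
  simp [Matrix.one_apply]

/-- A skew form is recovered from its values on the dual vectors. The factor `1/2` in `curvTensor`
is needed because the sum over all index pairs counts each wedge product twice. -/
theorem AdaptedFrame.curvForm_eq_sum (hx : x ∈ F.O) (α β : a) (i j : b) (v w : Coord a b) :
    curvForm F.A α i β j x v w =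
      ∑ γ, ∑ k, ∑ ε, ∑ l, curvTensor F.A α i β j γ k ε l x *
        (omega F.A (Sum.inl ε) (Sum.inr l) x v * omega F.A (Sum.inl γ) (Sum.inr k) x w -
          omega F.A (Sum.inl ε) (Sum.inr l) x w * omega F.A (Sum.inl γ) (Sum.inr k) x v) := by
  let D : LinearMap.BilinForm ℝ (Coord a b) :=
    (1 : Matrix a a ℝ) α β • (∑ γ, LinearMap.BilinForm.linMulLin
      (omega F.A (Sum.inr j) (Sum.inl γ) x : Coord a b →ₗ[ℝ] ℝ)
      (omega F.A (Sum.inl γ) (Sum.inr i) x : Coord a b →ₗ[ℝ] ℝ)) -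
    (1 : Matrix b b ℝ) j i • ∑ k, LinearMap.BilinForm.linMulLin
      (omega F.A (Sum.inl α) (Sum.inr k) x : Coord a b →ₗ[ℝ] ℝ)
      (omega F.A (Sum.inr k) (Sum.inl β) x : Coord a b →ₗ[ℝ] ℝ)
  let Ω : LinearMap.BilinForm ℝ (Coord a b) := D - D.flip
  have hΩ : ∀ v w, curvForm F.A α i β j x v w = Ω v w := by
    intro v w
    rw [F.curvForm_eq hx]
    simp [Ω, D, LinearMap.sum_apply, Finset.sum_sub_distrib]
    ring
  have hskew : Ω w v = -Ω v w := by simp [Ω]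
  have hexp : ∀ v w, Ω v w = ∑ γ, ∑ k, ∑ ε, ∑ l, Ω (dual F.A ε l x) (dual F.A γ k x) *
      (omega F.A (Sum.inl ε) (Sum.inr l) x v * omega F.A (Sum.inl γ) (Sum.inr k) x w) := by
    intro v w
    conv_lhs => rw [F.eq_sum_dual hx v, F.eq_sum_dual hx w]
    simp only [map_sum, map_smul, LinearMap.sum_apply, LinearMap.smul_apply, smul_eq_mul,
      Finset.mul_sum]
    exact Finset.sum_congr rfl fun _ _ => Finset.sum_congr rfl fun _ _ =>
      Finset.sum_congr rfl fun _ _ => Finset.sum_congr rfl fun _ _ => by ring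
  have h2 : ∑ γ, ∑ k, ∑ ε, ∑ l, curvTensor F.A α i β j γ k ε l x *
        (omega F.A (Sum.inl ε) (Sum.inr l) x v * omega F.A (Sum.inl γ) (Sum.inr k) x w -
          omega F.A (Sum.inl ε) (Sum.inr l) x w * omega F.A (Sum.inl γ) (Sum.inr k) x v) =
      (1 / 2) * (Ω v w - Ω w v) := by
    rw [hexp v w, hexp w v]
    simp_rw [curvTensor, hΩ, ← Finset.sum_sub_distrib, Finset.mul_sum]
    exact Finset.sum_congr rfl fun _ _ => Finset.sum_congr rfl fun _ _ =>
      Finset.sum_congr rfl fun _ _ => Finset.sum_congr rfl fun _ _ => by ring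
  rw [h2, hskew, hΩ]
  ring

/-- The full traces of the Kronecker deltas produce the cardinalities of `a` and `b`; the two
remaining terms are those where the contraction meets an index of `λ`. -/
theorem AdaptedFrame.ricci_eq (hx : x ∈ F.O) (β γ : a) (j k : b) :
    ricci F.A β γ j k x = (1 / 2) * (fundTensor F.A γ β j k x + fundTensor F.A β γ k j x -
      ((Fintype.card a : ℝ) + Fintype.card b) * fundTensor F.A β γ j k x) := by
  simp_rw [ricci, F.curvTensor_eq hx, mul_sub, Finset.sum_sub_distrib]
  simp [Matrix.one_apply]
  ring

end Curvature

/-! ### Curvature and Ricci tensors of the polar normalization -/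

section PolarCurvature

variable {U : Set (Submodule ℝ V)} {B : LinearMap.BilinForm ℝ V}
variable (F : AdaptedFrame a b U (polarMap B)) {x : Coord a b}

theorem AdaptedFrame.metric_eq_gram (hB : B.IsSymm) (hBn : B.Nondegenerate) (hx : x ∈ F.O)
    (v w : Coord a b) :
    metric F.A x v w =
      -∑ α, ∑ β, ∑ i, ∑ j, gramInv B F.A x α β * gramN B F.A x i j *
        omega F.A (Sum.inl α) (Sum.inr i) x v * omega F.A (Sum.inl β) (Sum.inr j) x w := by
  rw [F.metric_eq_fundTensor hx (F.fundTensor_symm hB hBn hx), ← Finset.sum_neg_distrib]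
  refine Finset.sum_congr rfl fun α _ => ?_
  rw [Finset.sum_comm, ← Finset.sum_neg_distrib]
  refine Finset.sum_congr rfl fun β _ => ?_
  simp_rw [← Finset.sum_neg_distrib, F.fundTensor_eq hB hBn hx]
  exact Finset.sum_congr rfl fun _ _ => Finset.sum_congr rfl fun _ _ => by ring

theorem AdaptedFrame.curvLower_eq (hB : B.IsSymm) (hBn : B.Nondegenerate) (hx : x ∈ F.O)
    (α β γ ε : a) (i j k l : b) :
    curvLower B F.A α i β j γ k ε l x = (1 / 2 : ℝ) *
      (gramInv B F.A x α β * gramInv B F.A x γ ε *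
          (gramN B F.A x i l * gramN B F.A x j k - gramN B F.A x i k * gramN B F.A x j l) +
        (gramInv B F.A x α ε * gramInv B F.A x β γ - gramInv B F.A x α γ * gramInv B F.A x β ε) *
          gramN B F.A x i j * gramN B F.A x k l) := by
  simp_rw [curvLower, F.curvTensor_eq hx, F.fundTensor_eq hB hBn hx]
  -- The deltas are split into a factor depending on `δ` and one depending on `h`, so that the
  -- double sum factors and each sum collapses.
  have h : ∀ δ h, gramInv B F.A x α δ * gramN B F.A x i h * ((1 / 2) *
      ((1 : Matrix a a ℝ) δ β * (-(gramInv B F.A x γ ε * gramN B F.A x j l) *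
          (1 : Matrix b b ℝ) h k - -(gramInv B F.A x ε γ * gramN B F.A x j k) *
          (1 : Matrix b b ℝ) h l) -
        (1 : Matrix b b ℝ) j h * ((1 : Matrix a a ℝ) δ ε *
            -(gramInv B F.A x β γ * gramN B F.A x l k) -
          (1 : Matrix a a ℝ) δ γ * -(gramInv B F.A x β ε * gramN B F.A x k l)))) =
      (gramInv B F.A x α δ * (1 : Matrix a a ℝ) δ β) * (-(1 / 2) *
        (gramInv B F.A x γ ε * gramN B F.A x j l) *
          (gramN B F.A x i h * (1 : Matrix b b ℝ) h k)) +
      (gramInv B F.A x α δ * (1 : Matrix a a ℝ) δ β) * ((1 / 2) *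
        (gramInv B F.A x γ ε * gramN B F.A x j k) *
          (gramN B F.A x i h * (1 : Matrix b b ℝ) h l)) +
      (gramInv B F.A x α δ * (1 : Matrix a a ℝ) δ ε) * ((1 / 2) *
        (gramInv B F.A x β γ * gramN B F.A x k l) *
          (gramN B F.A x i h * (1 : Matrix b b ℝ) j h)) +
      (gramInv B F.A x α δ * (1 : Matrix a a ℝ) δ γ) * (-(1 / 2) *
        (gramInv B F.A x β ε * gramN B F.A x k l) *
          (gramN B F.A x i h * (1 : Matrix b b ℝ) j h)) := by
    intro δ h
    rw [gramInv_symm hB _ _ ε γ, gramN_symm hB _ _ l k]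
    ring
  simp_rw [h, Finset.sum_add_distrib, ← Finset.mul_sum, ← Finset.sum_mul]
  simp [Matrix.one_apply]
  ring

theorem AdaptedFrame.ricci_eq_gram (hB : B.IsSymm) (hBn : B.Nondegenerate) (hx : x ∈ F.O)
    (β γ : a) (j k : b) :
    ricci F.A β γ j k x = (1 / 2 : ℝ) * ((Fintype.card a : ℝ) + Fintype.card b - 2) *
      (gramInv B F.A x β γ * gramN B F.A x j k) := by
  rw [F.ricci_eq hx, F.fundTensor_eq hB hBn hx, F.fundTensor_eq hB hBn hx,
    F.fundTensor_eq hB hBn hx, gramInv_symm hB _ _ γ β, gramN_symm hB _ _ k j]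
  ring

theorem AdaptedFrame.sum_ricci_mul (hB : B.IsSymm) (hBn : B.Nondegenerate) (hx : x ∈ F.O)
    (v w : Coord a b) :
    ∑ β, ∑ γ, ∑ j, ∑ k, ricci F.A β γ j k x * omega F.A (Sum.inl β) (Sum.inr j) x v *
        omega F.A (Sum.inl γ) (Sum.inr k) x w =
      -((1 / 2 : ℝ) * ((Fintype.card a : ℝ) + Fintype.card b - 2)) * metric F.A x v w := by
  rw [F.metric_eq_gram hB hBn hx, neg_mul_neg]
  simp_rw [F.ricci_eq_gram hB hBn hx, Finset.mul_sum]
  exact Finset.sum_congr rfl fun _ _ => Finset.sum_congr rfl fun _ _ =>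
    Finset.sum_congr rfl fun _ _ => Finset.sum_congr rfl fun _ _ => by ring

end PolarCurvature

/-! ### The affine connection and its torsion -/

section AffineConnection

variable {U : Set (Submodule ℝ V)} {ν : Submodule ℝ V → Submodule ℝ V}
variable (F : AdaptedFrame a b U ν) {x : Coord a b}

/-- Since `theta` is injective on `O`, identities between covariant derivatives may be checked on
these coframe components. -/
theorem AdaptedFrame.theta_covDeriv (hx : x ∈ F.O) (X Y : Coord a b → Coord a b) (α : a)
    (i : b) :
    theta F.A x (covDeriv F.A X Y x) α i =
      fderiv ℝ (fun y => theta F.A y (Y y) α i) x (X x) +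
        ∑ β, ∑ j, connForm F.A α i β j x (X x) * theta F.A x (Y x) β j := by
  rw [covDeriv, F.theta_inverse hx]

theorem AdaptedFrame.sum_connForm (v : Coord a b) (y : Coord a b) (α : a) (i : b) :
    ∑ β, ∑ j, connForm F.A α i β j x v * y β j =
      (∑ j, omega F.A (Sum.inr j) (Sum.inr i) x v * y α j) -
        ∑ β, omega F.A (Sum.inl α) (Sum.inl β) x v * y β i := by
  simp_rw [connForm_apply, sub_mul, Finset.sum_sub_distrib]
  simp [Matrix.one_apply]

theorem AdaptedFrame.contDiffOn_theta_apply {Y : Coord a b → Coord a b}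
    (hY : ContDiffOn ℝ ∞ Y F.O) (α : a) (i : b) :
    ContDiffOn ℝ ∞ (fun y => theta F.A y (Y y) α i) F.O :=
  (F.contDiffOn_omega (Sum.inl α) (Sum.inr i)).clm_apply hY

theorem AdaptedFrame.differentiableAt_theta_apply (hx : x ∈ F.O) {Y : Coord a b → Coord a b}
    (hY : ContDiffOn ℝ ∞ Y F.O) (α : a) (i : b) :
    DifferentiableAt ℝ (fun y => theta F.A y (Y y) α i) x :=
  ((F.contDiffOn_theta_apply hY α i).contDiffAt (F.isOpen_O.mem_nhds hx)).differentiableAt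
    (by simp)

theorem AdaptedFrame.isAffineConnection : IsAffineConnection F.O (covDeriv F.A) where
  smooth X Y hX hY := by
    refine F.contDiffOn_theta_inverse.clm_apply ?_
    refine contDiffOn_pi.2 fun α => contDiffOn_pi.2 fun i => ContDiffOn.add ?_ ?_
    · exact ((F.contDiffOn_theta_apply hY α i).fderiv_of_isOpen F.isOpen_O
        (by simp)).clm_apply hX
    · refine ContDiffOn.sum fun β _ => ContDiffOn.sum fun j _ => ContDiffOn.mul ?_ ?_
      · refine ContDiffOn.clm_apply ?_ hX
        exact ((F.contDiffOn_omega (Sum.inr j) (Sum.inr i)).const_smul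
          ((1 : Matrix a a ℝ) α β)).sub ((F.contDiffOn_omega (Sum.inl α) (Sum.inl β)).const_smul
            ((1 : Matrix b b ℝ) j i))
      · exact F.contDiffOn_theta_apply hY β j
  add_left X X' Y _ _ _ x hx := by
    apply F.theta_injective hx
    ext α i
    simp only [map_add, Pi.add_apply, F.theta_covDeriv hx, add_mul, Finset.sum_add_distrib]
    ring
  smul_left f X Y _ _ _ x hx := by
    apply F.theta_injective hx
    ext α i
    simp only [map_smul, Pi.smul_apply, F.theta_covDeriv hx, smul_eq_mul, mul_add,
      Finset.mul_sum, mul_assoc]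
  add_right X Y Y' _ hY hY' x hx := by
    apply F.theta_injective hx
    ext α i
    simp only [map_add, Pi.add_apply, F.theta_covDeriv hx, mul_add, Finset.sum_add_distrib]
    rw [fderiv_fun_add (F.differentiableAt_theta_apply hx hY α i)
      (F.differentiableAt_theta_apply hx hY' α i), add_apply]
    ring
  leibniz f X Y hf _ hY x hx := by
    apply F.theta_injective hx
    ext α i
    have hfx : DifferentiableAt ℝ f x :=
      (hf.contDiffAt (F.isOpen_O.mem_nhds hx)).differentiableAt (by simp)
    simp only [map_add, map_smul, Pi.add_apply, Pi.smul_apply, F.theta_covDeriv hx,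
      smul_eq_mul]
    rw [fderiv_fun_mul hfx (F.differentiableAt_theta_apply hx hY α i)]
    simp only [add_apply, smul_apply, smul_eq_mul, mul_add, Finset.mul_sum,
      mul_left_comm (f x)]
    ring

theorem AdaptedFrame.fderiv_theta_apply (hx : x ∈ F.O) {Y : Coord a b → Coord a b}
    (hY : ContDiffOn ℝ ∞ Y F.O) (α : a) (i : b) (v : Coord a b) :
    fderiv ℝ (fun y => theta F.A y (Y y) α i) x v =
      fderiv ℝ (omega F.A (Sum.inl α) (Sum.inr i)) x v (Y x) +
        theta F.A x (fderiv ℝ Y x v) α i := by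
  have hYx : DifferentiableAt ℝ Y x :=
    (hY.contDiffAt (F.isOpen_O.mem_nhds hx)).differentiableAt (by simp)
  simp_rw [theta_apply]
  rw [fderiv_clm_apply (F.differentiableAt_omega hx _ _) hYx]
  simp [add_comm]

/-- The torsion form is `dω_α^i + ω_j^i ∧ ω_α^j - ω_α^β ∧ ω_β^i`, which vanishes by the structure
equation for `ω_α^i`. -/
theorem AdaptedFrame.covDeriv_torsion_free (hx : x ∈ F.O) {X Y : Coord a b → Coord a b}
    (hX : ContDiffOn ℝ ∞ X F.O) (hY : ContDiffOn ℝ ∞ Y F.O) :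
    covDeriv F.A X Y x - covDeriv F.A Y X x = VectorField.lieBracket ℝ X Y x := by
  apply F.theta_injective hx
  ext α i
  have hd := F.extDerivOne_omega hx (Sum.inl α) (Sum.inr i) (X x) (Y x)
  simp only [extDerivOne, Fintype.sum_sum_type, Finset.sum_sub_distrib,
    mul_comm (omega F.A (Sum.inl α) (Sum.inr _) x _)] at hd
  simp only [VectorField.lieBracket, map_sub, Pi.sub_apply, F.theta_covDeriv hx,
    F.fderiv_theta_apply hx hX, F.fderiv_theta_apply hx hY, F.sum_connForm]
  simp only [theta_apply] at hd ⊢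
  linarith

end AffineConnection

/-! ### Compatibility of the connection with the metric -/

section LeviCivita

theorem sum_swap_outer {ι κ : Type*} [Fintype ι] [Fintype κ] (f : ι → κ → ι → ℝ) :
    ∑ i, ∑ q, ∑ k, f i q k = ∑ i, ∑ q, ∑ k, f k q i := by
  rw [Finset.sum_comm]
  conv_rhs => rw [Finset.sum_comm]
  exact Finset.sum_congr rfl fun q _ => Finset.sum_comm

/-- The transport of the connection coefficients from a twice covariant tensor to its
arguments. -/
theorem sum_connection_adjoint (l : a → a → b → b → ℝ) (P : a → a → ℝ) (N : b → b → ℝ)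
    (y z : a → b → ℝ) :
    ∑ α, ∑ i, ∑ β, ∑ j, ((∑ k, l α β i k * N j k) + (∑ k, l α β k j * N i k) -
        (∑ γ, l α γ i j * P γ β) - ∑ γ, l γ β i j * P γ α) * y α i * z β j =
      (∑ α, ∑ i, ∑ β, ∑ j, l α β i j * ((∑ k, N k i * y α k) - ∑ γ, P α γ * y γ i) * z β j) +
        ∑ α, ∑ i, ∑ β, ∑ j, l α β i j * y α i *
          ((∑ k, N k j * z β k) - ∑ γ, P β γ * z γ j) := by
  have h1 : ∑ α, ∑ i, ∑ β, ∑ j, (∑ k, l α β i k * N j k) * y α i * z β j =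
      ∑ α, ∑ i, ∑ β, ∑ j, l α β i j * y α i * ∑ k, N k j * z β k := by
    simp_rw [Finset.mul_sum, Finset.sum_mul]
    refine Finset.sum_congr rfl fun α _ => Finset.sum_congr rfl fun i _ =>
      Finset.sum_congr rfl fun β _ => ?_
    rw [Finset.sum_comm]
    exact Finset.sum_congr rfl fun _ _ => Finset.sum_congr rfl fun _ _ => by ring
  have h2 : ∑ α, ∑ i, ∑ β, ∑ j, (∑ k, l α β k j * N i k) * y α i * z β j =
      ∑ α, ∑ i, ∑ β, ∑ j, l α β i j * (∑ k, N k i * y α k) * z β j := by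
    simp_rw [Finset.mul_sum, Finset.sum_mul]
    refine Finset.sum_congr rfl fun α _ => ?_
    have := sum_swap_outer fun (i : b) (q : a × b) (k : b) =>
      l α q.1 k q.2 * N i k * y α i * z q.1 q.2
    simp only [Fintype.sum_prod_type] at this
    rw [this]
    exact Finset.sum_congr rfl fun _ _ => Finset.sum_congr rfl fun _ _ =>
      Finset.sum_congr rfl fun _ _ => Finset.sum_congr rfl fun _ _ => by ring
  have h3 : ∑ α, ∑ i, ∑ β, ∑ j, (∑ γ, l α γ i j * P γ β) * y α i * z β j =
      ∑ α, ∑ i, ∑ β, ∑ j, l α β i j * y α i * ∑ γ, P β γ * z γ j := by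
    simp_rw [Finset.mul_sum, Finset.sum_mul]
    refine Finset.sum_congr rfl fun α _ => Finset.sum_congr rfl fun i _ => ?_
    rw [sum_swap_outer]
    exact Finset.sum_congr rfl fun _ _ => Finset.sum_congr rfl fun _ _ =>
      Finset.sum_congr rfl fun _ _ => by ring
  have h4 : ∑ α, ∑ i, ∑ β, ∑ j, (∑ γ, l γ β i j * P γ α) * y α i * z β j =
      ∑ α, ∑ i, ∑ β, ∑ j, l α β i j * (∑ γ, P α γ * y γ i) * z β j := by
    simp_rw [Finset.mul_sum, Finset.sum_mul]
    have := sum_swap_outer fun (α : a) (q : b × a × b) (γ : a) =>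
      l γ q.2.1 q.1 q.2.2 * P γ α * y α q.1 * z q.2.1 q.2.2
    simp only [Fintype.sum_prod_type] at this
    rw [this]
    exact Finset.sum_congr rfl fun _ _ => Finset.sum_congr rfl fun _ _ =>
      Finset.sum_congr rfl fun _ _ => Finset.sum_congr rfl fun _ _ =>
        Finset.sum_congr rfl fun _ _ => by ring
  simp only [sub_mul, add_mul, mul_sub, Finset.sum_sub_distrib, Finset.sum_add_distrib]
  rw [h1, h2, h3, h4]
  ring

variable {U : Set (Submodule ℝ V)} {ν : Submodule ℝ V → Submodule ℝ V}
variable (F : AdaptedFrame a b U ν) {x : Coord a b}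

/-- In the coframe the metric has components `λ`. By `∇λ = 0` their differential consists of
connection terms, which `sum_connection_adjoint` moves onto the two vector fields. Only harmonicity
and `∇λ = 0` enter, not the polarity. -/
theorem AdaptedFrame.covDeriv_metric
    (hsymm : ∀ y ∈ F.O, ∀ α β i j, fundTensor F.A α β i j y = fundTensor F.A β α j i y)
    (hnabla : ∀ y ∈ F.O, ∀ v α β i j, nablaFund F.A α β i j y v = 0)
    (hx : x ∈ F.O) {X Y Z : Coord a b → Coord a b}
    (hY : ContDiffOn ℝ ∞ Y F.O) (hZ : ContDiffOn ℝ ∞ Z F.O) :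
    fderiv ℝ (fun y => metric F.A y (Y y) (Z y)) x (X x) =
      metric F.A x (covDeriv F.A X Y x) (Z x) + metric F.A x (Y x) (covDeriv F.A X Z x) := by
  have hO := F.isOpen_O.mem_nhds hx
  have hev : (fun y => metric F.A y (Y y) (Z y)) =ᶠ[nhds x] fun y =>
      ∑ α, ∑ i, ∑ β, ∑ j, fundTensor F.A α β i j y * theta F.A y (Y y) α i *
        theta F.A y (Z y) β j := by
    filter_upwards [hO] with y hy
    exact F.metric_eq_fundTensor hy (hsymm y hy) _ _
  have hl : ∀ α β i j, HasFDerivAt (fundTensor F.A α β i j) _ x := fun α β i j =>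
    (((F.contDiffOn_fundTensor α β i j).contDiffAt hO).differentiableAt (by simp)).hasFDerivAt
  have hder : HasFDerivAt (fun y => ∑ α, ∑ i, ∑ β, ∑ j, fundTensor F.A α β i j y *
      theta F.A y (Y y) α i * theta F.A y (Z y) β j) _ x :=
    HasFDerivAt.fun_sum fun α _ => HasFDerivAt.fun_sum fun i _ =>
      HasFDerivAt.fun_sum fun β _ => HasFDerivAt.fun_sum fun j _ =>
        ((hl α β i j).mul (F.differentiableAt_theta_apply hx hY α i).hasFDerivAt).mul
          (F.differentiableAt_theta_apply hx hZ β j).hasFDerivAt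
  have hdl : ∀ α β i j, fderiv ℝ (fundTensor F.A α β i j) x (X x) =
      (∑ k, fundTensor F.A α β i k x * omega F.A (Sum.inr j) (Sum.inr k) x (X x)) +
      (∑ k, fundTensor F.A α β k j x * omega F.A (Sum.inr i) (Sum.inr k) x (X x)) -
      (∑ γ, fundTensor F.A α γ i j x * omega F.A (Sum.inl γ) (Sum.inl β) x (X x)) -
      ∑ γ, fundTensor F.A γ β i j x * omega F.A (Sum.inl γ) (Sum.inl α) x (X x) := by
    intro α β i j
    have := hnabla x hx (X x) α β i j
    rw [nablaFund] at this
    linarith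
  have hadj := sum_connection_adjoint (fun α β i j => fundTensor F.A α β i j x)
    (fun α β => omega F.A (Sum.inl α) (Sum.inl β) x (X x))
    (fun i j => omega F.A (Sum.inr i) (Sum.inr j) x (X x))
    (theta F.A x (Y x)) (theta F.A x (Z x))
  rw [hev.fderiv_eq, hder.fderiv, F.metric_eq_fundTensor hx (hsymm x hx),
    F.metric_eq_fundTensor hx (hsymm x hx)]
  simp only [← theta_apply, F.theta_covDeriv hx, F.sum_connForm, ← hdl] at hadj ⊢
  simp only [sum_apply, add_apply, smul_apply, smul_eq_mul, mul_add, add_mul,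
    Finset.sum_add_distrib]
  simp only [Pi.mul_apply, mul_comm (theta F.A x (Z x) _ _) (_ * _),
    mul_comm (theta F.A x (Y x) _ _) (fderiv ℝ _ _ _)]
  linarith

end LeviCivita

/-! ### The pseudo-Riemannian metric and its Levi-Civita connection -/

section PolarLeviCivita

variable {U : Set (Submodule ℝ V)} {B : LinearMap.BilinForm ℝ V}
variable (F : AdaptedFrame a b U (polarMap B)) {x : Coord a b}

theorem isSymm_metric (A : Coord a b → Basis (a ⊕ b) ℝ V) (x : Coord a b) :
    (metric A x).IsSymm := ⟨fun v w => by
  simp only [metric_apply]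
  congr 1
  exact Finset.sum_congr rfl fun _ _ => Finset.sum_congr rfl fun _ _ => by ring⟩

theorem AdaptedFrame.isPseudoRiemannian (hB : B.IsSymm) (hBn : B.Nondegenerate) :
    IsPseudoRiemannian F.O (metric F.A) where
  smooth v w := by
    simp_rw [metric_apply]
    refine contDiffOn_const.mul (ContDiffOn.sum fun α _ => ContDiffOn.sum fun i _ => ?_)
    have h : ∀ ξ η, ∀ v, ContDiffOn ℝ ∞ (fun x => omega F.A ξ η x v) F.O := fun ξ η v =>
      (F.contDiffOn_omega ξ η).clm_apply contDiffOn_const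
    exact ((h _ _ v).mul (h _ _ w)).add ((h _ _ v).mul (h _ _ w))
  symm x _ := isSymm_metric F.A x
  nondegenerate x hx := by
    refine (LinearMap.IsRefl.nondegenerate_iff_separatingLeft (isSymm_metric F.A x).isRefl).2 fun v hv => ?_
    -- By harmonicity, pairing `v` with the dual vector of index `(α, i)` gives `ω_i^α(v)`. Once
    -- these vanish, `gramP_omega` and the invertibility of `(g_{ij})` force every `ω_α^i(v)` to
    -- vanish.
    have h1 : ∀ α i, omega F.A (Sum.inr i) (Sum.inl α) x v = 0 := by
      intro α i
      have h := hv (dual F.A α i x)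
      rw [F.metric_eq_fundTensor hx (F.fundTensor_symm hB hBn hx)] at h
      rw [F.omega_inr_inl_eq_fundTensor hx, ← h]
      simp [F.omega_dual hx, Matrix.one_apply, F.fundTensor_symm hB hBn hx α]
    have h2 : ∀ α i, ∑ j, gramN B F.A x i j * omega F.A (Sum.inl α) (Sum.inr j) x v = 0 := by
      intro α i
      have h := F.gramP_omega hB hx α i v
      simp_rw [h1, mul_zero, Finset.sum_const_zero] at h
      linarith
    have h3 : ∀ α, (fun j => omega F.A (Sum.inl α) (Sum.inr j) x v) = 0 := fun α =>
      Matrix.eq_zero_of_mulVec_eq_zero (F.isUnit_det_gram hB hBn hx).2.ne_zero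
        (funext fun i => h2 α i)
    rw [F.eq_sum_dual hx v]
    refine Finset.sum_eq_zero fun α _ => Finset.sum_eq_zero fun i _ => ?_
    rw [show omega F.A (Sum.inl α) (Sum.inr i) x v = 0 from congrFun (h3 α) i, zero_smul]

theorem AdaptedFrame.isLeviCivita (hB : B.IsSymm) (hBn : B.Nondegenerate) :
    IsLeviCivita F.O (metric F.A) (covDeriv F.A) where
  connection := F.isAffineConnection
  torsion_free _ _ hX hY _ hx := F.covDeriv_torsion_free hx hX hY
  metric _ _ _ _ hY hZ _ hx := F.covDeriv_metric
    (fun _ hy _ _ _ _ => F.fundTensor_symm hB hBn hy _ _ _ _)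
    (fun _ hy _ _ _ _ _ => F.nablaFund_eq_zero hB hBn hy _ _ _ _ _) hx hY hZ

end PolarLeviCivita

/-! ### Independence of the metric from coordinates and frames -/

section MetricInvariance

/-- The projection onto the span of the `A_α` along the span of the `A_i`. -/
def frameProj (A : Coord a b → Basis (a ⊕ b) ℝ V) (x : Coord a b) : V →L[ℝ] V :=
  ∑ α, (LinearMap.toContinuousLinearMap ((A x).coord (Sum.inl α))).smulRight (A x (Sum.inl α))

theorem frameProj_apply (A : Coord a b → Basis (a ⊕ b) ℝ V) (x : Coord a b) (u : V) :
    frameProj A x u = ∑ α, (A x).coord (Sum.inl α) u • A x (Sum.inl α) := by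
  simp [frameProj, sum_apply]

theorem frameProj_inl (A : Coord a b → Basis (a ⊕ b) ℝ V) (x : Coord a b) (α : a) :
    frameProj A x (A x (Sum.inl α)) = A x (Sum.inl α) := by
  simp [frameProj_apply, Finsupp.single_apply]

theorem frameProj_inr (A : Coord a b → Basis (a ⊕ b) ℝ V) (x : Coord a b) (i : b) :
    frameProj A x (A x (Sum.inr i)) = 0 := by
  simp [frameProj_apply]

theorem frameProj_eq_self (A : Coord a b → Basis (a ⊕ b) ℝ V) (x : Coord a b) {u : V}
    (hu : u ∈ Submodule.span ℝ (range fun α => A x (Sum.inl α))) : frameProj A x u = u := by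
  induction hu using Submodule.span_induction with
  | mem u h => obtain ⟨α, rfl⟩ := h; exact frameProj_inl A x α
  | zero => exact map_zero _
  | add u u' _ _ h h' => rw [map_add, h, h']
  | smul c u _ h => rw [map_smul, h]

theorem frameProj_eq_zero (A : Coord a b → Basis (a ⊕ b) ℝ V) (x : Coord a b) {u : V}
    (hu : u ∈ Submodule.span ℝ (range fun i => A x (Sum.inr i))) : frameProj A x u = 0 := by
  induction hu using Submodule.span_induction with
  | mem u h => obtain ⟨i, rfl⟩ := h; exact frameProj_inr A x i
  | zero => exact map_zero _
  | add u u' _ _ h h' => rw [map_add, h, h', add_zero]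
  | smul c u _ h => rw [map_smul, h, smul_zero]

variable {U : Set (Submodule ℝ V)} {ν : Submodule ℝ V → Submodule ℝ V}
variable (F : AdaptedFrame a b U ν) {x : Coord a b}

theorem AdaptedFrame.differentiableAt_frameProj (hx : x ∈ F.O) :
    DifferentiableAt ℝ (frameProj F.A) x := by
  have : ContDiffOn ℝ ∞ (frameProj F.A) F.O := by
    refine contDiffOn_clm_apply.2 fun u => ?_
    simp_rw [frameProj_apply]
    exact ContDiffOn.sum fun α _ => ((contDiffOn_coord F.smooth (Sum.inl α)).clm_apply
      contDiffOn_const).smul (F.smooth (Sum.inl α))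
  exact (this.contDiffAt (F.isOpen_O.mem_nhds hx)).differentiableAt (by simp)

/-- This is the product rule for `P A_ξ`, with `P` the projection. As `P A_α = A_α` and `P A_i = 0`,
it shows that `dP` interchanges `p` and its normalizing subspace. -/
theorem AdaptedFrame.fderiv_frameProj_apply (hx : x ∈ F.O) (ξ : a ⊕ b) (v : Coord a b) :
    fderiv ℝ (frameProj F.A) x v (F.A x ξ) =
      fderiv ℝ (fun y => frameProj F.A y (F.A y ξ)) x v -
        ∑ α, omega F.A ξ (Sum.inl α) x v • F.A x (Sum.inl α) := by
  rw [fderiv_clm_apply (F.differentiableAt_frameProj hx) (F.differentiableAt_frame hx ξ)]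
  simp [fderiv_frame, frameProj_inl, frameProj_inr]

theorem AdaptedFrame.fderiv_frameProj_inl (hx : x ∈ F.O) (α : a) (v : Coord a b) :
    fderiv ℝ (frameProj F.A) x v (F.A x (Sum.inl α)) =
      ∑ i, omega F.A (Sum.inl α) (Sum.inr i) x v • F.A x (Sum.inr i) := by
  rw [F.fderiv_frameProj_apply hx]
  simp [frameProj_inl, fderiv_frame]

theorem AdaptedFrame.fderiv_frameProj_inr (hx : x ∈ F.O) (i : b) (v : Coord a b) :
    fderiv ℝ (frameProj F.A) x v (F.A x (Sum.inr i)) =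
      -∑ α, omega F.A (Sum.inr i) (Sum.inl α) x v • F.A x (Sum.inl α) := by
  rw [F.fderiv_frameProj_apply hx]
  simp [frameProj_inr]

/-- The metric is `-1/2` times the trace form of the differential of the projection. -/
theorem AdaptedFrame.metric_eq_trace (hx : x ∈ F.O) (v w : Coord a b) :
    metric F.A x v w = -(1 / 2) * LinearMap.trace ℝ V
      ((fderiv ℝ (frameProj F.A) x v : V →ₗ[ℝ] V) ∘ₗ
        (fderiv ℝ (frameProj F.A) x w : V →ₗ[ℝ] V)) := by
  rw [metric_apply, LinearMap.trace_eq_matrix_trace ℝ (F.A x), Matrix.trace]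
  simp only [Matrix.diag_apply, LinearMap.toMatrix_apply, Fintype.sum_sum_type,
    LinearMap.comp_apply, ContinuousLinearMap.coe_coe, F.fderiv_frameProj_inl hx,
    F.fderiv_frameProj_inr hx, map_neg, map_sum, map_smul, Finsupp.neg_apply,
    Finsupp.finsetSum_apply, Finsupp.smul_apply, Basis.repr_self, Finsupp.single_apply,
    smul_eq_mul, Sum.inl.injEq, Sum.inr.injEq, mul_ite, mul_one, mul_zero,
    Finset.sum_ite_eq', Finset.mem_univ, if_true, mul_neg, Finset.sum_neg_distrib]
  rw [Finset.sum_comm (s := (Finset.univ : Finset b))]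
  simp only [Finset.sum_add_distrib, mul_comm (omega F.A _ _ x w)]
  ring

/-- The projection is determined by `p` and `ν(p)` alone, so the two frame fields give the same
projection after composition with `φ`. The chain rule and the trace formula finish, for any `ν`. -/
theorem metricWellDefined (U : Set (Submodule ℝ V)) (ν : Submodule ℝ V → Submodule ℝ V) :
    MetricWellDefined a b U ν := by
  intro F F' O φ hO hOF hφ hφs hspan x hx v w
  have hP : ∀ y ∈ O, frameProj F'.A (φ y) = frameProj F.A y := by
    intro y hy
    apply ContinuousLinearMap.coe_injective
    refine (F.A y).ext fun ξ => ?_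
    rcases ξ with α | i
    · simp only [ContinuousLinearMap.coe_coe, frameProj_inl]
      refine frameProj_eq_self _ _ ?_
      rw [hspan y hy]
      exact Submodule.subset_span ⟨α, rfl⟩
    · simp only [ContinuousLinearMap.coe_coe, frameProj_inr]
      refine frameProj_eq_zero _ _ ?_
      rw [F'.span_normalizing _ (hφ hy), hspan y hy, ← F.span_normalizing _ (hOF hy)]
      exact Submodule.subset_span ⟨i, rfl⟩
  have hd : fderiv ℝ (frameProj F.A) x = (fderiv ℝ (frameProj F'.A) (φ x)).comp (fderiv ℝ φ x) := by
    rw [← fderiv_comp x (F'.differentiableAt_frameProj (hφ hx))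
      ((hφs.contDiffAt (hO.mem_nhds hx)).differentiableAt (by simp))]
    refine Filter.EventuallyEq.fderiv_eq ?_
    filter_upwards [hO.mem_nhds hx] with y hy using (hP y hy).symm
  rw [F'.metric_eq_trace (hφ hx), F.metric_eq_trace (hOF hx), hd]
  rfl

end MetricInvariance

/-! ### Inertia indices and openness of the domain -/

section Signature

open QuadraticMap

/-- Nondegenerate real quadratic forms on spaces of the same dimension with the same positive
index of inertia are isometric. -/
theorem equivalent_of_sigPos_eq {M N : Type*} [AddCommGroup M] [Module ℝ M]
    [FiniteDimensional ℝ M] [AddCommGroup N] [Module ℝ N] [FiniteDimensional ℝ N]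
    {Q : QuadraticForm ℝ M} {Q' : QuadraticForm ℝ N}
    (hQ : (associated (R := ℝ) Q).SeparatingLeft) (hQ' : (associated (R := ℝ) Q').SeparatingLeft)
    (hdim : finrank ℝ M = finrank ℝ N) (hsig : sigPos Q = sigPos Q') : Q.Equivalent Q' := by
  classical
  obtain ⟨w, hw, he⟩ := QuadraticForm.equivalent_one_neg_one_weighted_sum_squared Q hQ
  obtain ⟨w', hw', he'⟩ := QuadraticForm.equivalent_one_neg_one_weighted_sum_squared Q' hQ'
  rw [QuadraticForm.sigPos_of_equiv_weightedSumSquares he,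
    QuadraticForm.sigPos_of_equiv_weightedSumSquares he'] at hsig
  have hcard : Fintype.card {i // 0 < w i} = Fintype.card {i // 0 < w' i} := by
    simpa [Set.ncard_eq_toFinset_card', Fintype.card_subtype] using hsig
  have hcard' : Fintype.card {i // ¬0 < w i} = Fintype.card {i // ¬0 < w' i} := by
    rw [Fintype.card_subtype_compl, Fintype.card_subtype_compl, hcard, Fintype.card_fin,
      Fintype.card_fin, hdim]
  -- Positive weights are matched with positive ones and the rest with the rest. All weights being
  -- `1` or `-1`, the sign determines the weight.
  let σ : Fin (finrank ℝ M) ≃ Fin (finrank ℝ N) := (Equiv.sumCompl fun i => 0 < w i).symm.trans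
    (((Fintype.equivOfCardEq hcard).sumCongr (Fintype.equivOfCardEq hcard')).trans
      (Equiv.sumCompl fun i => 0 < w' i))
  have hσ : ∀ i, w' (σ i) = w i := by
    intro i
    by_cases h : 0 < w i
    · have h1 : 0 < w' (σ i) := by
        have hs : (Equiv.sumCompl fun i => 0 < w i).symm i = Sum.inl ⟨i, h⟩ :=
          (Equiv.symm_apply_eq _).2 rfl
        simp only [σ, Equiv.trans_apply, hs]
        exact (Fintype.equivOfCardEq hcard ⟨i, h⟩).2
      rcases hw i with h2 | h2 <;> rcases hw' (σ i) with h3 | h3 <;> linarith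
    · have h1 : ¬0 < w' (σ i) := by
        have hs : (Equiv.sumCompl fun i => 0 < w i).symm i = Sum.inr ⟨i, h⟩ :=
          (Equiv.symm_apply_eq _).2 rfl
        simp only [σ, Equiv.trans_apply, hs]
        exact (Fintype.equivOfCardEq hcard' ⟨i, h⟩).2
      rcases hw i with h2 | h2 <;> rcases hw' (σ i) with h3 | h3 <;> linarith
  refine he.trans (Equivalent.trans ⟨⟨LinearEquiv.funCongrLeft ℝ ℝ σ.symm, fun v => ?_⟩⟩ he'.symm)
  rw [weightedSumSquares_apply, weightedSumSquares_apply, ← σ.sum_comp]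
  simp [hσ]

variable {B : LinearMap.BilinForm ℝ V}

theorem restrictForm_apply (p : Submodule ℝ V) (u : p) : restrictForm B p u = B u u := rfl

theorem neg_restrictForm (p : Submodule ℝ V) : -restrictForm B p = restrictForm (-B) p := by
  ext u
  simp [restrictForm_apply]

theorem sigNeg_restrictForm (p : Submodule ℝ V) :
    sigNeg (restrictForm B p) = sigPos (restrictForm (-B) p) := by
  rw [← neg_restrictForm, sigPos_neg]

theorem associated_restrictForm (hB : B.IsSymm) (p : Submodule ℝ V) :
    associated (R := ℝ) (restrictForm B p) = B.restrict p :=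
  associated_left_inverse ℝ fun x y => hB.eq x y

/-- The two indices fall short of the dimension by the dimension of the radical. Nondegeneracy thus
becomes a numerical condition. -/
theorem restrict_nondegenerate_iff_sig (hB : B.IsSymm) (p : Submodule ℝ V) :
    (B.restrict p).Nondegenerate ↔
      sigPos (restrictForm B p) + sigNeg (restrictForm B p) = finrank ℝ p := by
  have h := QuadraticForm.sigPos_add_sigNeg_add_radical (Q := restrictForm B p)
  have h' : (B.restrict p).Nondegenerate ↔ (radical (restrictForm B p)) = ⊥ := by
    rw [← associated_restrictForm hB, ← nondegenerate_iff_radical_eq_bot]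
    exact nondegenerate_associated_iff
  rw [h', ← Submodule.finrank_eq_zero (R := ℝ)]
  omega

theorem sig_add_le (p : Submodule ℝ V) :
    sigPos (restrictForm B p) + sigNeg (restrictForm B p) ≤ finrank ℝ p := by
  have h := QuadraticForm.sigPos_add_sigNeg_add_radical (Q := restrictForm B p)
  omega

theorem exists_posDef_le (B : LinearMap.BilinForm ℝ V) (p : Submodule ℝ V) :
    ∃ W ≤ p, finrank ℝ W = sigPos (restrictForm B p) ∧ ∀ u ∈ W, u ≠ 0 → 0 < B u u := by
  obtain ⟨W, hW, hpos⟩ := exists_finrank_eq_sigPos_and_posDef (restrictForm B p)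
  refine ⟨W.map p.subtype, Submodule.map_subtype_le _ _, ?_, ?_⟩
  · rw [Submodule.finrank_map_subtype_eq, hW]
  · rintro _ ⟨u, hu, rfl⟩ h0
    exact hpos ⟨u, hu⟩ fun h => h0 (by simpa using congrArg (fun z : W => (z : p)) h)

theorem finrank_le_sigPos {W p : Submodule ℝ V} (hW : W ≤ p)
    (hpos : ∀ u ∈ W, u ≠ 0 → 0 < B u u) : finrank ℝ W ≤ sigPos (restrictForm B p) := by
  have h : ((restrictForm B p).restrict (W.comap p.subtype)).PosDef := by
    rintro ⟨u, hu⟩ h0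
    exact hpos u hu fun h => h0 (by ext; exact h)
  have := le_sigPos_of_posDef _ h
  rwa [(Submodule.comapSubtypeEquivOfLe hW).finrank_eq] at this

/-- The sum of maximal positive definite subspaces of `p` and `q` is direct and, by orthogonality,
again positive definite. -/
theorem sigPos_add_le_of_orthogonal {p q : Submodule ℝ V} (hpq : Disjoint p q)
    (h1 : ∀ u ∈ p, ∀ v ∈ q, B u v = 0) (h2 : ∀ u ∈ p, ∀ v ∈ q, B v u = 0) :
    sigPos (restrictForm B p) + sigPos (restrictForm B q) ≤ sigPos (restrictForm B ⊤) := by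
  obtain ⟨W, hW, hWf, hWp⟩ := exists_posDef_le B p
  obtain ⟨W', hW', hWf', hWp'⟩ := exists_posDef_le B q
  have hdim := Submodule.finrank_sup_add_finrank_inf_eq W W'
  rw [(hpq.mono hW hW').eq_bot, finrank_bot, add_zero] at hdim
  rw [← hWf, ← hWf', ← hdim]
  refine finrank_le_sigPos le_top fun u hu h0 => ?_
  obtain ⟨y, hy, z, hz, rfl⟩ := Submodule.mem_sup.1 hu
  simp only [map_add, LinearMap.add_apply, h1 y (hW hy) z (hW' hz), h2 y (hW hy) z (hW' hz)]
  by_cases hy0 : y = 0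
  · have hz0 : z ≠ 0 := fun h => h0 (by rw [hy0, h, add_zero])
    simpa [hy0] using hWp' z hz hz0
  · have hyp := hWp y hy hy0
    by_cases hz0 : z = 0
    · simpa [hz0] using hyp
    · have := hWp' z hz hz0
      linarith

/-- Superadditivity for `B` and for `-B` gives two inequalities. The four indices on the left
already add up to the dimension of `V`, which bounds the sum of the two on the right, so both are
equalities. -/
theorem sig_orthogonal (hB : B.IsSymm) {p : Submodule ℝ V} (hp : (B.restrict p).Nondegenerate) :
    (B.restrict (B.orthogonal p)).Nondegenerate →
    sigPos (restrictForm B p) + sigPos (restrictForm B (B.orthogonal p)) =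
        sigPos (restrictForm B ⊤) ∧
      sigNeg (restrictForm B p) + sigNeg (restrictForm B (B.orthogonal p)) =
        sigNeg (restrictForm B ⊤) := by
  intro hp'
  have hc := LinearMap.BilinForm.isCompl_orthogonal_of_restrict_nondegenerate hB.isRefl hp
  have h1 : ∀ u ∈ p, ∀ v ∈ B.orthogonal p, B u v = 0 := fun u hu v hv => hv u hu
  have h2 : ∀ u ∈ p, ∀ v ∈ B.orthogonal p, B v u = 0 := fun u hu v hv => by
    rw [hB.eq_iff]
    exact hv u hu
  have hpos := sigPos_add_le_of_orthogonal hc.disjoint h1 h2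
  have hneg := sigPos_add_le_of_orthogonal (B := -B) hc.disjoint
    (fun u hu v hv => by simp [h1 u hu v hv]) (fun u hu v hv => by simp [h2 u hu v hv])
  simp only [← sigNeg_restrictForm] at hneg
  have hd := Submodule.finrank_add_eq_of_isCompl hc
  have ht := sig_add_le (B := B) (⊤ : Submodule ℝ V)
  rw [finrank_top] at ht
  have e1 := (restrict_nondegenerate_iff_sig hB p).1 hp
  have e2 := (restrict_nondegenerate_iff_sig hB _).1 hp'
  omega

theorem restrict_orthogonal_nondegenerate (hB : B.IsSymm) (hBn : B.Nondegenerate)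
    {p : Submodule ℝ V} (hp : (B.restrict p).Nondegenerate) :
    (B.restrict (B.orthogonal p)).Nondegenerate := by
  rw [LinearMap.BilinForm.restrict_nondegenerate_iff_isCompl_orthogonal hB.isRefl,
    LinearMap.BilinForm.orthogonal_orthogonal hBn hB.isRefl]
  exact (LinearMap.BilinForm.isCompl_orthogonal_of_restrict_nondegenerate hB.isRefl hp).symm

/-- Additivity of the indices makes the conditions on the polar subspace redundant, and
nondegeneracy follows from the dimension and the two indices of `p`. -/
theorem mem_polarDomain_iff (hB : B.IsSymm) (hBn : B.Nondegenerate) {p₀ p : Submodule ℝ V}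
    (hp₀ : (B.restrict p₀).Nondegenerate) :
    p ∈ polarDomain B p₀ ↔ finrank ℝ p = finrank ℝ p₀ ∧
      sigPos (restrictForm B p) = sigPos (restrictForm B p₀) ∧
      sigNeg (restrictForm B p) = sigNeg (restrictForm B p₀) := by
  refine ⟨fun h => ⟨h.1, h.2.2.1, h.2.2.2.1⟩, fun ⟨h1, h2, h3⟩ => ?_⟩
  have hp : (B.restrict p).Nondegenerate := by
    rw [restrict_nondegenerate_iff_sig hB, h1, h2, h3, ← restrict_nondegenerate_iff_sig hB]
    exact hp₀
  have e1 := sig_orthogonal hB hp (restrict_orthogonal_nondegenerate hB hBn hp)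
  have e2 := sig_orthogonal hB hp₀ (restrict_orthogonal_nondegenerate hB hBn hp₀)
  exact ⟨h1, hp, h2, h3, by omega, by omega⟩

/-- The positive index of inertia is lower semicontinuous. -/
theorem eventually_sigPos_le {ι : Type} [Fintype ι] (B : LinearMap.BilinForm ℝ V) {c₀ : ι → V}
    (hc₀ : LinearIndependent ℝ c₀) :
    ∀ᶠ c in nhds c₀, LinearIndependent ℝ c →
      sigPos (restrictForm B (Submodule.span ℝ (range c₀))) ≤
        sigPos (restrictForm B (Submodule.span ℝ (range c))) := by
  obtain ⟨W, hW, hWf, hWp⟩ := exists_posDef_le B (Submodule.span ℝ (range c₀))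
  rw [← hWf]
  let T : (ι → V) → (ι → ℝ) →ₗ[ℝ] V := fun c => Fintype.linearCombination ℝ c
  have hinj : ∀ c, LinearIndependent ℝ c → Function.Injective (T c) := fun c hc => by
    exact linearIndependent_iff_injective_fintypeLinearCombination.1 hc
  -- `W'` is the positive definite subspace `W` read in coordinates with respect to `c₀`. The same
  -- coefficients applied to a nearby family `c` give the competing subspace of its span.
  let W' : Submodule ℝ (ι → ℝ) := W.comap (T c₀)
  have hmap : W'.map (T c₀) = W := by
    rw [Submodule.map_comap_eq, Fintype.range_linearCombination, inf_eq_right]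
    exact hW
  have hK : IsCompact ((W' : Set (ι → ℝ)) ∩ Metric.sphere 0 1) :=
    (isCompact_sphere _ _).inter_left W'.closed_of_finiteDimensional
  have hcont : Continuous fun z : (ι → V) × (ι → ℝ) => B (T z.1 z.2) (T z.1 z.2) := by
    have hT : Continuous fun z : (ι → V) × (ι → ℝ) => T z.1 z.2 := by
      simp only [T, Fintype.linearCombination_apply]
      fun_prop
    exact (B.toContinuousBilinearMap.continuous.comp hT).clm_apply hT
  -- Compactness of the unit sphere of `W'` makes positivity hold for all its points at once when
  -- `c` is near `c₀`; homogeneity extends it to nonzero vectors.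
  have hev : ∀ᶠ c in nhds c₀, ∀ t ∈ (W' : Set (ι → ℝ)) ∩ Metric.sphere 0 1,
      0 < B (T c t) (T c t) := by
    refine hK.eventually_forall_of_forall_eventually fun t ht => ?_
    refine hcont.continuousAt.eventually (lt_mem_nhds ?_)
    refine hWp _ ht.1 fun h0 => ?_
    have : t = 0 := hinj c₀ hc₀ (by rw [h0, map_zero])
    have ht2 := ht.2
    simp [this] at ht2
  filter_upwards [hev] with c hc hcl
  have hdim : finrank ℝ W = finrank ℝ (W'.map (T c)) := by
    rw [← hmap, ← (Submodule.equivMapOfInjective _ (hinj c₀ hc₀) W').finrank_eq,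
      ← (Submodule.equivMapOfInjective _ (hinj c hcl) W').finrank_eq]
  rw [hdim]
  refine finrank_le_sigPos ?_ ?_
  · rw [← Fintype.range_linearCombination]
    exact LinearMap.map_le_range
  · rintro _ ⟨t, ht, rfl⟩ h0
    have ht0 : t ≠ 0 := fun h => h0 (by rw [h, map_zero])
    have hn : 0 < ‖t‖ := norm_pos_iff.2 ht0
    have h := hc (‖t‖⁻¹ • t) ⟨W'.smul_mem _ ht, by simp [norm_smul, hn.ne']⟩
    simp only [map_smul, LinearMap.smul_apply, smul_eq_mul] at h
    have hi : 0 < ‖t‖⁻¹ := inv_pos.2 hn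
    exact pos_of_mul_pos_right (pos_of_mul_pos_right h hi.le) hi.le

/-- Near `c₀` neither index can drop, and their sum already equals the dimension, so neither can
grow. -/
theorem isOpen_polarDomain {ι : Type} [Fintype ι] (hB : B.IsSymm) (hBn : B.Nondegenerate)
    {p₀ : Submodule ℝ V} (hp₀ : (B.restrict p₀).Nondegenerate) :
    IsOpen {c : ι → V | LinearIndependent ℝ c ∧
      Submodule.span ℝ (range c) ∈ polarDomain B p₀} := by
  rw [isOpen_iff_mem_nhds]
  rintro c₀ ⟨hc₀, hmem⟩
  have hLI : ∀ᶠ c : ι → V in nhds c₀, LinearIndependent ℝ c :=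
    isOpen_setOfPred_linearIndependent.mem_nhds hc₀
  rw [mem_polarDomain_iff hB hBn hp₀] at hmem
  filter_upwards [hLI, eventually_sigPos_le B hc₀, eventually_sigPos_le (-B) hc₀]
    with c hc hpos hneg
  refine ⟨hc, ?_⟩
  rw [mem_polarDomain_iff hB hBn hp₀]
  have h1 := hpos hc
  have h2 := hneg hc
  rw [← sigNeg_restrictForm, ← sigNeg_restrictForm] at h2
  have h3 := sig_add_le (B := B) (Submodule.span ℝ (range c))
  have h4 := (restrict_nondegenerate_iff_sig hB p₀).1 hp₀
  have h5 := finrank_span_eq_card hc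
  have h6 := finrank_span_eq_card hc₀
  omega

end Signature

/-! ### Homogeneity under the isometries of the form -/

section Homogeneous

variable {B : LinearMap.BilinForm ℝ V}

theorem orthogonal_map_isometry (T : V ≃ₗ[ℝ] V) (hT : ∀ u v, B (T u) (T v) = B u v)
    (s : Submodule ℝ V) :
    B.orthogonal (s.map (T : V →ₗ[ℝ] V)) = (B.orthogonal s).map (T : V →ₗ[ℝ] V) := by
  ext v
  obtain ⟨v, rfl⟩ := T.surjective v
  have hm : T v ∈ (B.orthogonal s).map (T : V →ₗ[ℝ] V) ↔ v ∈ B.orthogonal s :=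
    T.injective.mem_set_image
  rw [hm]
  refine ⟨fun h u hu => ?_, ?_⟩
  · rw [← hT]
    exact h _ (Submodule.mem_map_of_mem hu)
  · rintro h _ ⟨u, hu, rfl⟩
    exact (hT u v).trans (h u hu)

theorem restrictForm_map_equivalent (T : V ≃ₗ[ℝ] V) (hT : ∀ u v, B (T u) (T v) = B u v)
    (s : Submodule ℝ V) :
    (restrictForm B (s.map (T : V →ₗ[ℝ] V))).Equivalent (restrictForm B s) :=
  QuadraticMap.Equivalent.symm ⟨⟨T.submoduleMap s, fun u => hT u u⟩⟩

theorem map_mem_polarDomain_iff (hB : B.IsSymm) (hBn : B.Nondegenerate) {p₀ : Submodule ℝ V}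
    (hp₀ : (B.restrict p₀).Nondegenerate) (T : V ≃ₗ[ℝ] V)
    (hT : ∀ u v, B (T u) (T v) = B u v) (s : Submodule ℝ V) :
    s.map (T : V →ₗ[ℝ] V) ∈ polarDomain B p₀ ↔ s ∈ polarDomain B p₀ := by
  have h := restrictForm_map_equivalent T hT s
  rw [mem_polarDomain_iff hB hBn hp₀, mem_polarDomain_iff hB hBn hp₀, h.sigPos_eq, h.sigNeg_eq,
    LinearEquiv.finrank_map_eq]

theorem restrictForm_equivalent (hB : B.IsSymm) {p q : Submodule ℝ V}
    (hp : (B.restrict p).Nondegenerate) (hq : (B.restrict q).Nondegenerate)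
    (hdim : finrank ℝ p = finrank ℝ q)
    (hsig : sigPos (restrictForm B p) = sigPos (restrictForm B q)) :
    (restrictForm B p).Equivalent (restrictForm B q) :=
  equivalent_of_sigPos_eq (by rw [associated_restrictForm hB]; exact hp.1)
    (by rw [associated_restrictForm hB]; exact hq.1) hdim hsig

/-- Isometries between two subspaces and between their polar subspaces are induced by an isometry
of the whole space. -/
theorem exists_isometry_map_eq (hB : B.IsSymm) {p q : Submodule ℝ V}
    (hp : IsCompl p (B.orthogonal p)) (hq : IsCompl q (B.orthogonal q))
    (h : (restrictForm B p).Equivalent (restrictForm B q))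
    (h' : (restrictForm B (B.orthogonal p)).Equivalent (restrictForm B (B.orthogonal q))) :
    ∃ T : V ≃ₗ[ℝ] V, (∀ u v, B (T u) (T v) = B u v) ∧ p.map (T : V →ₗ[ℝ] V) = q := by
  obtain ⟨e⟩ := h
  obtain ⟨e'⟩ := h'
  let T : V ≃ₗ[ℝ] V := (Submodule.prodEquivOfIsCompl p _ hp).symm.trans
    ((e.toLinearEquiv.prodCongr e'.toLinearEquiv).trans (Submodule.prodEquivOfIsCompl q _ hq))
  have hTadd : ∀ (u : p) (v : B.orthogonal p), T (u + v) = (e u : V) + (e' v : V) := by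
    intro u v
    have : (Submodule.prodEquivOfIsCompl p _ hp).symm (u + v) = (u, v) := by
      rw [LinearEquiv.symm_apply_eq]
      rfl
    simp only [T, LinearEquiv.trans_apply, this]
    rfl
  have hQ : ∀ u, B (T u) (T u) = B u u := by
    intro u
    obtain ⟨⟨y, z⟩, rfl⟩ := (Submodule.prodEquivOfIsCompl p _ hp).surjective u
    have hy : B (e y : V) (e y) = B y y := e.map_app y
    have hz : B (e' z : V) (e' z) = B z z := e'.map_app z
    have c1 : B (e y : V) (e' z) = 0 := (e' z).2 _ (e y).2
    have c2 : B (y : V) z = 0 := z.2 _ y.2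
    have c3 : B (e' z : V) (e y) = 0 := by rw [hB.eq_iff]; exact c1
    have c4 : B (z : V) y = 0 := by rw [hB.eq_iff]; exact c2
    rw [Submodule.coe_prodEquivOfIsCompl', hTadd]
    simp [hy, hz, c1, c2, c3, c4]
  refine ⟨T, fun u v => ?_, ?_⟩
  · have h1 := hQ (u + v)
    have h2 : B (T v) (T u) = B (T u) (T v) := hB.eq _ _
    have h3 : B v u = B u v := hB.eq _ _
    simp only [map_add, LinearMap.add_apply, hQ, h2, h3] at h1
    linarith
  · refine Submodule.eq_of_le_of_finrank_eq ?_ ?_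
    · rintro _ ⟨u, hu, rfl⟩
      have := hTadd ⟨u, hu⟩ 0
      simp only [Submodule.coe_zero, add_zero, map_zero] at this
      rw [LinearEquiv.coe_coe, this]
      exact (e ⟨u, hu⟩).2
    · rw [LinearEquiv.finrank_map_eq]
      exact e.toLinearEquiv.finrank_eq

/-- Equal signatures make `p`, `q` isometric and likewise `p*`, `q*`. An isometry of `V` gluing
these respects orthogonality and signatures, hence the domain and the normalization. -/
theorem isHomogeneous_polarDomain (hB : B.IsSymm) (hBn : B.Nondegenerate) {p₀ : Submodule ℝ V}
    (hp₀ : (B.restrict p₀).Nondegenerate) : IsHomogeneous (polarDomain B p₀) (polarMap B) := by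
  intro p hp q hq
  have hpc := LinearMap.BilinForm.isCompl_orthogonal_of_restrict_nondegenerate hB.isRefl hp.2.1
  have hqc := LinearMap.BilinForm.isCompl_orthogonal_of_restrict_nondegenerate hB.isRefl hq.2.1
  have hdim := (Submodule.finrank_add_eq_of_isCompl hpc).trans
    (Submodule.finrank_add_eq_of_isCompl hqc).symm
  have hpq : finrank ℝ p = finrank ℝ q := hp.1.trans hq.1.symm
  obtain ⟨T, hT, hTpq⟩ := exists_isometry_map_eq hB hpc hqc
    (restrictForm_equivalent hB hp.2.1 hq.2.1 hpq (hp.2.2.1.trans hq.2.2.1.symm))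
    (restrictForm_equivalent hB (restrict_orthogonal_nondegenerate hB hBn hp.2.1)
      (restrict_orthogonal_nondegenerate hB hBn hq.2.1) (by omega)
      (hp.2.2.2.2.1.trans hq.2.2.2.2.1.symm))
  exact ⟨T, hTpq, map_mem_polarDomain_iff hB hBn hp₀ T hT,
    fun s _ => orthogonal_map_isometry T hT s⟩

end Homogeneous

/-! ### The graph chart and smooth adapted frames -/

section LocalFrames

variable {B : LinearMap.BilinForm ℝ V} {p : Submodule ℝ V}

/-- The points `A_α + x_α^i A_i` depending on the coordinates `x`. -/
def chartPoint (A : Basis (a ⊕ b) ℝ V) (x : Coord a b) (α : a) : V :=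
  A (Sum.inl α) + ∑ i, x α i • A (Sum.inr i)

/-- The points `A_i - x_β^j (A_i, A_j) D_β` depending on the coordinates `x`, which are conjugate
to the points `A_α + x_α^i A_i` if the `D_β` are dual to the `A_α`. -/
def chartConjugate (B : LinearMap.BilinForm ℝ V) (A : Basis (a ⊕ b) ℝ V) (D : a → V)
    (x : Coord a b) (i : b) : V :=
  A (Sum.inr i) - ∑ β, (∑ j, x β j * B (A (Sum.inr i)) (A (Sum.inr j))) • D β

theorem exists_basis_of_isCompl {q : Submodule ℝ V} (hpq : IsCompl p q)
    (hp : finrank ℝ p = Fintype.card a) (hq : finrank ℝ q = Fintype.card b) :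
    ∃ A : Basis (a ⊕ b) ℝ V, (∀ α, A (Sum.inl α) ∈ p) ∧ ∀ i, A (Sum.inr i) ∈ q := by
  let bp : Basis a ℝ p := (finBasisOfFinrankEq ℝ p hp).reindex (Fintype.equivFin a).symm
  let bq : Basis b ℝ q := (finBasisOfFinrankEq ℝ q hq).reindex (Fintype.equivFin b).symm
  refine ⟨(bp.prod bq).map (Submodule.prodEquivOfIsCompl p q hpq), fun α => ?_, fun i => ?_⟩
  · simp
  · simp

theorem span_inl_eq (hp : finrank ℝ p = Fintype.card a) (A : Basis (a ⊕ b) ℝ V)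
    (hA : ∀ α, A (Sum.inl α) ∈ p) :
    Submodule.span ℝ (range fun α => A (Sum.inl α)) = p := by
  refine Submodule.eq_of_le_of_finrank_eq (Submodule.span_le.2 (range_subset_iff.2 hA)) ?_
  rw [hp]
  exact finrank_span_eq_card (A.linearIndependent.comp _ Sum.inl_injective)

/-- Vectors of `p` dual to a basis of `p`. -/
theorem exists_dual_vectors (hpn : (B.restrict p).Nondegenerate)
    (hp : finrank ℝ p = Fintype.card a) (A : Basis (a ⊕ b) ℝ V) (hA : ∀ α, A (Sum.inl α) ∈ p) :
    ∃ D : a → V, (∀ β, D β ∈ p) ∧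
      ∀ β α, B (D β) (A (Sum.inl α)) = (1 : Matrix a a ℝ) β α := by
  have hli : LinearIndependent ℝ fun α => (⟨A (Sum.inl α), hA α⟩ : p) :=
    LinearIndependent.of_comp p.subtype (A.linearIndependent.comp _ Sum.inl_injective)
  let bp : Basis a ℝ p :=
    Basis.mk hli (by
      rw [LinearIndependent.span_eq_top_of_card_eq_finrank' hli hp.symm])
  refine ⟨fun β => (LinearMap.BilinForm.dualBasis _ hpn bp β : p), fun β => Subtype.mem _,
    fun β α => ?_⟩
  have h := LinearMap.BilinForm.apply_dualBasis_left hpn bp β α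
  rw [Basis.mk_apply] at h
  simpa [Matrix.one_apply, eq_comm] using h

theorem bilin_chartPoint_chartConjugate (hB : B.IsSymm) (A : Basis (a ⊕ b) ℝ V) (D : a → V)
    (hA : ∀ α i, B (A (Sum.inl α)) (A (Sum.inr i)) = 0)
    (hD : ∀ β i, B (D β) (A (Sum.inr i)) = 0)
    (hDA : ∀ β α, B (D β) (A (Sum.inl α)) = (1 : Matrix a a ℝ) β α)
    (x : Coord a b) (α : a) (i : b) :
    B (chartPoint A x α) (chartConjugate B A D x i) = 0 := by
  rw [← hB.eq_iff]
  have hA' : ∀ α i, B (A (Sum.inr i)) (A (Sum.inl α)) = 0 := fun α i => by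
    rw [hB.eq_iff]
    exact hA α i
  simp [chartPoint, chartConjugate, hA', hD, hDA, Matrix.one_apply]

theorem coord_inr_chartConjugate (A : Basis (a ⊕ b) ℝ V) (D : a → V)
    (hD : ∀ β, D β ∈ Submodule.span ℝ (range fun α => A (Sum.inl α))) (x : Coord a b) (i k : b) :
    A.coord (Sum.inr k) (chartConjugate B A D x i) = (1 : Matrix b b ℝ) i k := by
  have h : ∀ u ∈ Submodule.span ℝ (range fun α => A (Sum.inl α)), A.coord (Sum.inr k) u = 0 := by
    intro u hu
    induction hu using Submodule.span_induction with
    | mem u h => obtain ⟨α, rfl⟩ := h; simp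
    | zero => exact map_zero _
    | add u u' _ _ h h' => rw [map_add, h, h', add_zero]
    | smul c u _ h => rw [map_smul, h, smul_zero]
  rw [chartConjugate, map_sub, map_sum]
  simp only [map_smul, h _ (hD _), smul_zero, Finset.sum_const_zero, sub_zero]
  simp [Finsupp.single_apply, Matrix.one_apply]

/-- Modulo the span of the `A_α` these vectors are the `A_i`, for every value of the coordinates. -/
theorem linearIndependent_chartConjugate (A : Basis (a ⊕ b) ℝ V) (D : a → V)
    (hD : ∀ β, D β ∈ Submodule.span ℝ (range fun α => A (Sum.inl α))) (x : Coord a b) :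
    LinearIndependent ℝ (chartConjugate B A D x) := by
  refine LinearIndependent.of_comp (LinearMap.pi fun k => A.coord (Sum.inr k)) ?_
  convert! Pi.linearIndependent_single_one b ℝ using 1
  funext i k
  simp only [Function.comp_apply, LinearMap.pi_apply, coord_inr_chartConjugate A D hD]
  simp [Matrix.one_apply, Pi.single_apply, eq_comm]

theorem linearIndependent_sumElim_chart (hB : B.IsSymm)
    (A : Basis (a ⊕ b) ℝ V) (D : a → V)
    (hD : ∀ β, D β ∈ Submodule.span ℝ (range fun α => A (Sum.inl α))) (x : Coord a b)
    (horth : ∀ α i, B (chartPoint A x α) (chartConjugate B A D x i) = 0)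
    (hli : LinearIndependent ℝ (chartPoint A x))
    (hnd : (B.restrict (Submodule.span ℝ (range (chartPoint A x)))).Nondegenerate) :
    Submodule.span ℝ (range (chartConjugate B A D x)) =
        B.orthogonal (Submodule.span ℝ (range (chartPoint A x))) ∧
      LinearIndependent ℝ (Sum.elim (chartPoint A x) (chartConjugate B A D x)) := by
  have hc := LinearMap.BilinForm.isCompl_orthogonal_of_restrict_nondegenerate hB.isRefl hnd
  have hli' := linearIndependent_chartConjugate (B := B) A D hD x
  have hspan : Submodule.span ℝ (range (chartConjugate B A D x)) =
      B.orthogonal (Submodule.span ℝ (range (chartPoint A x))) := by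
    refine Submodule.eq_of_le_of_finrank_eq (Submodule.span_le.2 ?_) ?_
    · rintro _ ⟨i, rfl⟩ u hu
      induction hu using Submodule.span_induction with
      | mem u h => obtain ⟨α, rfl⟩ := h; exact horth α i
      | zero => simp
      | add u u' _ _ h h' =>
        have h1 : B u _ = 0 := h
        have h2 : B u' _ = 0 := h'
        change B (u + u') _ = 0
        rw [map_add, LinearMap.add_apply, h1, h2, add_zero]
      | smul c u _ h =>
        have h1 : B u _ = 0 := h
        change B (c • u) _ = 0
        rw [map_smul, LinearMap.smul_apply, h1, smul_zero]
    · have h1 := Submodule.finrank_add_eq_of_isCompl hc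
      rw [finrank_span_eq_card hli, finrank_eq_card_basis A, Fintype.card_sum] at h1
      rw [finrank_span_eq_card hli']
      omega
  exact ⟨hspan, hli.sum_type hli' (by rw [hspan]; exact hc.disjoint)⟩

/-- If all `ω_α^i(v)` vanish, then `v_α^i A_i` (with the `A_i` of `A₀`) lies in the span of the
chart points. Such a span is a graph over the span of the `A_α`, so it meets the span of the `A_i`
only in zero, and `v = 0`. Equality of dimensions does the rest. -/
theorem isInvertible_theta_of_fderiv (A₀ : Basis (a ⊕ b) ℝ V) (A : Coord a b → Basis (a ⊕ b) ℝ V)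
    (x : Coord a b) (hA : ∀ α, A x (Sum.inl α) = chartPoint A₀ x α)
    (hd : ∀ α v, fderiv ℝ (fun y => A y (Sum.inl α)) x v = ∑ i, v α i • A₀ (Sum.inr i)) :
    (theta A x).IsInvertible := by
  have hinj : Function.Injective (theta A x : Coord a b →ₗ[ℝ] Coord a b) := by
    rw [← LinearMap.ker_eq_bot, LinearMap.ker_eq_bot']
    intro v hv
    have hω : ∀ α i, omega A (Sum.inl α) (Sum.inr i) x v = 0 := fun α i =>
      congrFun (congrFun hv α) i
    funext α i
    have h1 : ∑ j, v α j • A₀ (Sum.inr j) =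
        ∑ β, omega A (Sum.inl α) (Sum.inl β) x v • chartPoint A₀ x β := by
      rw [← hd, fderiv_frame]
      simp [hω, hA]
    have h2 : ∀ β, omega A (Sum.inl α) (Sum.inl β) x v = 0 := by
      intro β
      have := congrArg (A₀.coord (Sum.inl β)) h1
      simpa [chartPoint, Finsupp.single_apply] using this.symm
    simp only [h2, zero_smul, Finset.sum_const_zero] at h1
    have := congrArg (A₀.coord (Sum.inr i)) h1
    simpa [Finsupp.single_apply] using this
  exact ⟨(LinearEquiv.ofInjectiveEndo _ hinj).toContinuousLinearEquiv, by ext; rfl⟩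

theorem continuous_chartPoint (A : Basis (a ⊕ b) ℝ V) : Continuous (chartPoint A) := by
  unfold chartPoint
  fun_prop

theorem contDiff_chartPoint (A : Basis (a ⊕ b) ℝ V) (α : a) :
    ContDiff ℝ ∞ fun x => chartPoint A x α := by
  unfold chartPoint
  fun_prop

theorem contDiff_chartConjugate (A : Basis (a ⊕ b) ℝ V) (D : a → V) (i : b) :
    ContDiff ℝ ∞ fun x => chartConjugate B A D x i := by
  unfold chartConjugate
  fun_prop

theorem fderiv_chartPoint (A : Basis (a ⊕ b) ℝ V) (α : a) (x v : Coord a b) :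
    fderiv ℝ (fun y => chartPoint A y α) x v = ∑ i, v α i • A (Sum.inr i) := by
  let L : Coord a b →ₗ[ℝ] V :=
    ∑ i, (LinearMap.proj i ∘ₗ LinearMap.proj α : Coord a b →ₗ[ℝ] ℝ).smulRight (A (Sum.inr i))
  have hL : ∀ y, L y = ∑ i, y α i • A (Sum.inr i) := fun y => by simp [L, LinearMap.sum_apply]
  have h : (fun y => chartPoint A y α) = fun y => A (Sum.inl α) + L.toContinuousLinearMap y := by
    funext y
    simp [chartPoint, hL]
  rw [h, fderiv_const_add, ContinuousLinearMap.fderiv, ← hL]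
  rfl

theorem exists_adaptedFrame (hB : B.IsSymm) (hBn : B.Nondegenerate) {p₀ : Submodule ℝ V}
    (hp₀ : (B.restrict p₀).Nondegenerate) (hp : p ∈ polarDomain B p₀)
    (hpa : finrank ℝ p = Fintype.card a) (hpb : finrank ℝ (B.orthogonal p) = Fintype.card b) :
    ∃ F : AdaptedFrame a b (polarDomain B p₀) (polarMap B), ∃ x ∈ F.O,
      Submodule.span ℝ (range fun α => F.A x (Sum.inl α)) = p := by
  classical
  have hpn := hp.2.1
  obtain ⟨A₀, hA₀, hA₀'⟩ := exists_basis_of_isCompl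
    (LinearMap.BilinForm.isCompl_orthogonal_of_restrict_nondegenerate hB.isRefl hpn) hpa hpb
  obtain ⟨D, hDp, hDA⟩ := exists_dual_vectors hpn hpa A₀ hA₀
  have hspan := span_inl_eq hpa A₀ hA₀
  have hD : ∀ β, D β ∈ Submodule.span ℝ (range fun α => A₀ (Sum.inl α)) := by rwa [hspan]
  have horth := bilin_chartPoint_chartConjugate hB A₀ D
    (fun α i => hA₀' i _ (hA₀ α)) (fun β i => hA₀' i _ (hDp β)) hDA
  let O : Set (Coord a b) := {x | LinearIndependent ℝ (chartPoint A₀ x) ∧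
    Submodule.span ℝ (range (chartPoint A₀ x)) ∈ polarDomain B p₀}
  have hO : IsOpen O := (isOpen_polarDomain hB hBn hp₀).preimage (continuous_chartPoint A₀)
  have hfr := fun x (hx : x ∈ O) => linearIndependent_sumElim_chart hB A₀ D hD x (horth x) hx.1
    hx.2.2.1
  let A : Coord a b → Basis (a ⊕ b) ℝ V := fun x => if hx : x ∈ O then
    Basis.mk (hfr x hx).2
      (by rw [(hfr x hx).2.span_eq_top_of_card_eq_finrank' (finrank_eq_card_basis A₀).symm])
    else A₀
  have hA : ∀ x ∈ O, ∀ ξ, A x ξ = Sum.elim (chartPoint A₀ x) (chartConjugate B A₀ D x) ξ := by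
    intro x hx ξ
    simp only [A, dif_pos hx, Basis.mk_apply]
  have hAl : ∀ x ∈ O, (fun α => A x (Sum.inl α)) = chartPoint A₀ x := fun x hx =>
    funext fun α => hA x hx (Sum.inl α)
  have hAr : ∀ x ∈ O, (fun i => A x (Sum.inr i)) = chartConjugate B A₀ D x := fun x hx =>
    funext fun i => hA x hx (Sum.inr i)
  let F : AdaptedFrame a b (polarDomain B p₀) (polarMap B) :=
    { O := O
      A := A
      isOpen_O := hO
      smooth := by
        rintro (α | i)
        · exact (contDiff_chartPoint A₀ α).contDiffOn.congr fun x hx => hA x hx _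
        · exact (contDiff_chartConjugate A₀ D i).contDiffOn.congr fun x hx => hA x hx _
      span_mem := fun x hx => by
        rw [hAl x hx]
        exact hx.2
      span_normalizing := fun x hx => by
        rw [hAl x hx, hAr x hx]
        exact (hfr x hx).1
      coframe := fun x hx => by
        refine isInvertible_theta_of_fderiv A₀ A x (fun α => hA x hx _) fun α v => ?_
        have : (fun y => A y (Sum.inl α)) =ᶠ[nhds x] fun y => chartPoint A₀ y α := by
          filter_upwards [hO.mem_nhds hx] with y hy using hA y hy _
        rw [this.fderiv_eq, fderiv_chartPoint] }
  -- The subspace `p` is the origin of its own graph chart.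
  have h0 : chartPoint A₀ 0 = fun α => A₀ (Sum.inl α) := by
    funext α
    simp [chartPoint]
  have h0O : (0 : Coord a b) ∈ O := by
    refine ⟨?_, ?_⟩
    · rw [h0]
      exact A₀.linearIndependent.comp _ Sum.inl_injective
    · rw [h0, hspan]
      exact hp
  refine ⟨F, 0, h0O, ?_⟩
  change Submodule.span ℝ (range fun α => A 0 (Sum.inl α)) = p
  rw [hAl 0 h0O, h0, hspan]

theorem isNormalization_polarMap (hB : B.IsSymm) (hBn : B.Nondegenerate) {p₀ : Submodule ℝ V}
    (hp₀ : (B.restrict p₀).Nondegenerate) (ha : finrank ℝ p₀ = Fintype.card a)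
    (hab : finrank ℝ V = Fintype.card a + Fintype.card b) :
    IsNormalization a b (polarDomain B p₀) (polarMap B) := by
  have hc : ∀ p ∈ polarDomain B p₀, IsCompl p (B.orthogonal p) := fun p hp =>
    LinearMap.BilinForm.isCompl_orthogonal_of_restrict_nondegenerate hB.isRefl hp.2.1
  have hfa : ∀ p ∈ polarDomain B p₀, finrank ℝ p = Fintype.card a := fun p hp => hp.1.trans ha
  have hfb : ∀ p ∈ polarDomain B p₀, finrank ℝ (B.orthogonal p) = Fintype.card b := by
    intro p hp
    have h1 := Submodule.finrank_add_eq_of_isCompl (hc p hp)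
    have h2 := hfa p hp
    omega
  exact ⟨hfa, isOpen_polarDomain hB hBn hp₀, hfb, hc,
    fun p hp => exists_adaptedFrame hB hBn hp₀ hp (hfa p hp) (hfb p hp)⟩

end LocalFrames

end

end Grassmann

/-! ### The main theorem -/

theorem mainTheorem4 {V : Type*} [NormedAddCommGroup V] [NormedSpace ℝ V]
    [FiniteDimensional ℝ V] (m n : ℕ) (hmn : m < n) (hV : Module.finrank ℝ V = n + 1)
    (B : LinearMap.BilinForm ℝ V) (hBsymm : B.IsSymm) (hBnondeg : B.Nondegenerate)
    (p₀ : Submodule ℝ V) (hp₀ : Module.finrank ℝ p₀ = m + 1)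
    (hp₀nt : (B.restrict p₀).Nondegenerate) :
    p₀ ∈ Grassmann.polarDomain B p₀ ∧
    Grassmann.IsNormalization (Fin (m + 1)) (Fin (n - m))
      (Grassmann.polarDomain B p₀) (Grassmann.polarMap B) ∧
    Grassmann.IsHarmonic (Fin (m + 1)) (Fin (n - m))
      (Grassmann.polarDomain B p₀) (Grassmann.polarMap B) ∧
    Grassmann.IsNondegenerate (Fin (m + 1)) (Fin (n - m))
      (Grassmann.polarDomain B p₀) (Grassmann.polarMap B) ∧
    Grassmann.IsCovariantlyConstant (Fin (m + 1)) (Fin (n - m))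
      (Grassmann.polarDomain B p₀) (Grassmann.polarMap B) ∧
    Grassmann.MetricWellDefined (Fin (m + 1)) (Fin (n - m))
      (Grassmann.polarDomain B p₀) (Grassmann.polarMap B) ∧
    Grassmann.IsHomogeneous (Grassmann.polarDomain B p₀) (Grassmann.polarMap B) ∧
    ∀ F : Grassmann.AdaptedFrame (Fin (m + 1)) (Fin (n - m))
        (Grassmann.polarDomain B p₀) (Grassmann.polarMap B),
      Grassmann.IsPseudoRiemannian F.O (Grassmann.metric F.A) ∧
      Grassmann.IsLeviCivita F.O (Grassmann.metric F.A) (Grassmann.covDeriv F.A) ∧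
      ∀ x ∈ F.O,
        -- the matrices `g_{αβ}` and `g_{ij}` are nondegenerate
        IsUnit (Grassmann.gramP B F.A x).det ∧ IsUnit (Grassmann.gramN B F.A x).det ∧
        -- the fundamental tensor
        (∀ α β i j, Grassmann.fundTensor F.A α β i j x =
          -(Grassmann.gramInv B F.A x α β * Grassmann.gramN B F.A x i j)) ∧
        (∀ v α i, Grassmann.omega F.A (Sum.inr i) (Sum.inl α) x v =
          -∑ β, ∑ j, Grassmann.gramInv B F.A x α β * Grassmann.gramN B F.A x i j *
            Grassmann.omega F.A (Sum.inl β) (Sum.inr j) x v) ∧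
        -- the metric
        (∀ v w, Grassmann.metric F.A x v w =
          -∑ α, ∑ β, ∑ i, ∑ j, Grassmann.gramInv B F.A x α β * Grassmann.gramN B F.A x i j *
            Grassmann.omega F.A (Sum.inl α) (Sum.inr i) x v *
            Grassmann.omega F.A (Sum.inl β) (Sum.inr j) x w) ∧
        -- the curvature forms are `R_{αjkl}^{iβγε} ω_ε^l ∧ ω_γ^k`
        (∀ v w α i β j, Grassmann.curvForm F.A α i β j x v w =
          ∑ γ, ∑ k, ∑ ε, ∑ l, Grassmann.curvTensor F.A α i β j γ k ε l x *
            (Grassmann.omega F.A (Sum.inl ε) (Sum.inr l) x v *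
                Grassmann.omega F.A (Sum.inl γ) (Sum.inr k) x w
              - Grassmann.omega F.A (Sum.inl ε) (Sum.inr l) x w *
                Grassmann.omega F.A (Sum.inl γ) (Sum.inr k) x v)) ∧
        -- the curvature tensor
        (∀ α i β j γ k ε l, Grassmann.curvLower B F.A α i β j γ k ε l x =
          (1 / 2 : ℝ) *
            (Grassmann.gramInv B F.A x α β * Grassmann.gramInv B F.A x γ ε *
                (Grassmann.gramN B F.A x i l * Grassmann.gramN B F.A x j k
                  - Grassmann.gramN B F.A x i k * Grassmann.gramN B F.A x j l)
              + (Grassmann.gramInv B F.A x α ε * Grassmann.gramInv B F.A x β γ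
                  - Grassmann.gramInv B F.A x α γ * Grassmann.gramInv B F.A x β ε) *
                Grassmann.gramN B F.A x i j * Grassmann.gramN B F.A x k l)) ∧
        -- the Ricci tensor
        (∀ β γ j k, Grassmann.ricci F.A β γ j k x =
          (1 / 2 : ℝ) * ((n : ℝ) - 1) *
            (Grassmann.gramInv B F.A x β γ * Grassmann.gramN B F.A x j k)) ∧
        -- the Einstein condition: the Ricci form is a constant multiple of the metric
        (∀ v w, ∑ β, ∑ γ, ∑ j, ∑ k, Grassmann.ricci F.A β γ j k x *
            Grassmann.omega F.A (Sum.inl β) (Sum.inr j) x v *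
            Grassmann.omega F.A (Sum.inl γ) (Sum.inr k) x w =
          -((1 / 2 : ℝ) * ((n : ℝ) - 1)) * Grassmann.metric F.A x v w) := by
  have ha : Module.finrank ℝ p₀ = Fintype.card (Fin (m + 1)) := by simpa using hp₀
  have hab : Module.finrank ℝ V =
      Fintype.card (Fin (m + 1)) + Fintype.card (Fin (n - m)) := by
    rw [hV, Fintype.card_fin, Fintype.card_fin]
    omega
  -- The two index ranges together have `n + 1` elements; subtracting the two terms from the Ricci
  -- contraction leaves the Einstein factor `n - 1`.
  have hn : (Fintype.card (Fin (m + 1)) : ℝ) + Fintype.card (Fin (n - m)) - 2 = (n : ℝ) - 1 := by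
    rw [← Nat.cast_add, ← hab, hV]
    push_cast
    ring
  refine ⟨⟨rfl, hp₀nt, rfl, rfl, rfl, rfl⟩,
    Grassmann.isNormalization_polarMap hBsymm hBnondeg hp₀nt ha hab,
    Grassmann.isHarmonic_polarMap hBsymm hBnondeg,
    Grassmann.isNondegenerate_polarMap hBsymm hBnondeg,
    Grassmann.isCovariantlyConstant_polarMap hBsymm hBnondeg,
    Grassmann.metricWellDefined _ _,
    Grassmann.isHomogeneous_polarDomain hBsymm hBnondeg hp₀nt, fun F =>
    ⟨F.isPseudoRiemannian hBsymm hBnondeg, F.isLeviCivita hBsymm hBnondeg, fun x hx =>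
    ⟨(F.isUnit_det_gram hBsymm hBnondeg hx).1, (F.isUnit_det_gram hBsymm hBnondeg hx).2,
    F.fundTensor_eq hBsymm hBnondeg hx, F.omega_inr_inl hBsymm hBnondeg hx,
    F.metric_eq_gram hBsymm hBnondeg hx,
    fun v w α i β j => F.curvForm_eq_sum hx α β i j v w,
    fun α i β j γ k ε l => F.curvLower_eq hBsymm hBnondeg hx α β γ ε i j k l,
    fun β γ j k => ?_, fun v w => ?_⟩⟩⟩
  · rw [F.ricci_eq_gram hBsymm hBnondeg hx, hn]
  · rw [F.sum_ricci_mul hBsymm hBnondeg hx, hn]
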